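/- Let $\mathbb{F}_q$ be a finite field with $q$ elements, let $P = P(t) \in \mathbb{F}_q[t]$ be a monic irreducible polynomial, and let $H$ be an $\mathbb{F}_q[t]$-module of finite length such that every element of $H$ is annihilated by some power of $P$. Write $h := \dim_{\mathbb{F}_q}(H)$. For $A \in \mathrm{Mat}_n(\mathbb{F}_q)$, regard $\mathbb{F}_q^n$ as an $\mathbb{F}_q[t]$-module on which $t$ acts as $A$, and let $A[P^\infty] := \{x \in \mathbb{F}_q^n : P(A)^N x = 0 \text{ for some } N \ge 0\}$, an $\mathbb{F}_q[t]$-submodule. For integers $n, d \ge 0$ let $b_n(d)$ be defined by $$\sum_{n=0}^{\infty} b_n(d) u^n = \prod_{i=1}^{\infty} \frac{1 - (q^{-i}u)^d}{1 - q^{1-i}u} \in \mathbb{C}[[u]],$$ where the infinite product converges coefficientwise. Then for every integer $n \ge 0$, for $A$ uniformly distributed in $\mathrm{Mat}_n(\mathbb{F}_q)$, $$\mathrm{Prob}_{A \in \mathrm{Mat}_n(\mathbb{F}_q)}\bigl(A[P^\infty] \simeq H \text{ as } \mathbb{F}_q[t]\text{-modules}\bigr) = \begin{cases} \dfrac{b_{n-h}(\deg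 P)}{|\mathrm{Aut}_{\mathbb{F}_q[t]}(H)|} \displaystyle\prod_{i=1}^{n} (1 - q^{-i}) & \text{if } n \ge h, \\ 0 & \text{if } n < h. \end{cases}$$ Moreover, for every integer $d \ge 0$, $$\lim_{n \to \infty} b_n(d) = \prod_{i=1}^{\infty} \frac{1 - q^{-id}}{1 - q^{-i}},$$ and $$\lim_{n \to \infty} \mathrm{Prob}_{A \in \mathrm{Mat}_n(\mathbb{F}_q)}\bigl(A[P^\infty] \simeq H\bigr) = \frac{1}{|\mathrm{Aut}_{\mathbb{F}_q[t]}(H)|} \prod_{i=1}^{\infty} \bigl(1 - q^{-i \deg P}\bigr),$$ where all the infinite products converge. -/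

import Mathlib

open Polynomial Filter Topology
open scoped PowerSeries PowerSeries.WithPiTopology

/-- The `R`-module `M[P^∞] = {x ∈ M : P ^ N • x = 0 for some (equivalently, all large) N}`. -/
abbrev primePowerTorsion (R M : Type*) [CommRing R] [AddCommGroup M] [Module R M] (P : R) :
    Submodule R M :=
  Submodule.torsion' R M (Submonoid.powers P)

/-- The `K[t]`-module `Kⁿ` on which `t` acts as the matrix `A` (by `v ↦ A *ᵥ v`). -/
abbrev matrixModule {K : Type*} [Field K] {n : ℕ} (A : Matrix (Fin n) (Fin n) K) : Type _ :=
  Module.AEval' (Matrix.toLin' A)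

/-- The probability of an event under the uniform distribution on a finite nonempty type. -/
noncomputable def uniformProb {Ω : Type*} [Finite Ω] (E : Set Ω) : ℝ :=
  (Nat.card E : ℝ) / (Nat.card Ω : ℝ)

/-- The probability that `A[P^∞] ≃ H`, as `K[t]`-modules, for `A` uniform in `Mat_n(K)`. -/
noncomputable def probPartIso {K : Type*} [Field K] [Finite K] (P : K[X])
    (H : Type*) [AddCommGroup H] [Module K[X] H] (n : ℕ) : ℝ :=
  uniformProb {A : Matrix (Fin n) (Fin n) K |
    Nonempty (primePowerTorsion K[X] (matrixModule A) P ≃ₗ[K[X]] H)}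

/-- The factor `(1 - (q^{-i} u)^d) / (1 - q^{1-i} u)` in `ℂ⟦u⟧`, where `i = j + 1`. -/
noncomputable def bFactor (q d j : ℕ) : ℂ⟦X⟧ :=
  (1 - (PowerSeries.C ((q : ℂ)⁻¹ ^ (j + 1)) * PowerSeries.X) ^ d) *
    (1 - PowerSeries.C ((q : ℂ)⁻¹ ^ j) * PowerSeries.X)⁻¹

/-- The coefficient `b_n(d)` of `u^n` in `∏_{i ≥ 1} (1 - (q^{-i} u)^d) / (1 - q^{1-i} u)`; the
infinite product is taken in `ℂ⟦u⟧` with the topology of coefficientwise convergence. -/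
noncomputable def bCoeff (q n d : ℕ) : ℂ :=
  PowerSeries.coeff n (∏' j : ℕ, bFactor q d j)

/-! The proof is a double count of pairs (A, ψ), where A is an endomorphism of V = K^n and ψ embeds
a fixed K[t]-module E in V so that P acts injectively on the quotient.

For E = H the fibre over A is the set of isomorphisms from H to A[P^∞], hence empty or a torsor
under Aut H (`card_isoTorsion_mul_card_aut`). The fibre over an injective ψ consists of block
triangular matrices, and has q^(h(n-h)) r_(n-h) elements, with r_m the number of B in Mat_m(K) for
which P(B) is injective (`card_regularEmbedding`). This gives the probability in terms of a_(n-h),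
where a_m = r_m / |GL_m(K)|.

To see that a_m = b_m(deg P), the same count is applied to the cyclic modules E = K[t]/(f). A pair
(B, v) with P(B) injective amounts to a monic f prime to P, the annihilator of v, with a regular
embedding of K[t]/(f) sending 1 to v (`regularCount_mul_card`). Divided by |GL_n|, this becomes R(u)
= (1 - (u/q)^d)/(1 - u) · R(u/q) for R = ∑ a_n u^n. The infinite product satisfies the same
equation, whose solution is determined by its constant term (`functionalEquation_unique`).

For the limit, the recursion bounds the b_n, so B(x) = ∑ b_n x^n converges for |x| < 1. The partial
sums of the coefficients of (1 - u)B are the b_n, so b_n tends to (1 - q^(-d)) B(1/q); iterating the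
functional equation from x = 1/q evaluates this as the product. -/

/-- The number of endomorphisms `B` of `V` for which `P(B)` is injective. -/
noncomputable def regularCount {K : Type*} [Field K] (P : K[X]) (V : Type*) [AddCommGroup V]
    [Module K V] : ℕ :=
  Nat.card {B : Module.End K V // Function.Injective (aeval B P)}

/-- The `K`-linear map `ψ : E → V` embeds the `K[t]`-module `E` into `V`, on which `t` acts as `A`,
and `P` acts injectively on the quotient. -/
structure IsRegularEmbedding {K E V : Type*} [Field K] [AddCommGroup E] [Module K E]
    [Module K[X] E] [AddCommGroup V] [Module K V] (P : K[X]) (A : Module.End K V)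
    (ψ : E →ₗ[K] V) : Prop where
  injective : Function.Injective ψ
  map_X_smul : ∀ x, ψ ((X : K[X]) • x) = A (ψ x)
  mem_range : ∀ v, aeval A P v ∈ LinearMap.range ψ → v ∈ LinearMap.range ψ

/-! ### Counting regular embeddings. -/

section Counting

variable {K : Type*} [Field K]

theorem aeval_apply_of_semiconj {V W : Type*} [AddCommGroup V] [Module K V] [AddCommGroup W]
    [Module K W] {A : Module.End K V} {B : Module.End K W} {f : V →ₗ[K] W}
    (h : ∀ v, f (A v) = B (f v)) (p : K[X]) (v : V) : f (aeval A p v) = aeval B p (f v) := by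
  induction p using Polynomial.induction_on generalizing v with
  | C a => simp [Module.algebraMap_end_apply]
  | add p r hp hr => simp [hp, hr]
  | monomial n a ih =>
    have hA : ∀ w, aeval A (C a * X ^ (n + 1)) w = aeval A (C a * X ^ n) (A w) := by
      intro w; simp [pow_succ]
    have hB : ∀ w, aeval B (C a * X ^ (n + 1)) w = aeval B (C a * X ^ n) (B w) := by
      intro w; simp [pow_succ]
    rw [hA, hB, ih, h]

theorem map_smul_of_map_X_smul {E V : Type*} [AddCommGroup E] [Module K E] [Module K[X] E]
    [IsScalarTower K K[X] E] [AddCommGroup V] [Module K V] {A : Module.End K V} {f : E →ₗ[K] V}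
    (h : ∀ x, f ((X : K[X]) • x) = A (f x)) (p : K[X]) (x : E) :
    f (p • x) = aeval A p (f x) := by
  have := aeval_apply_of_semiconj (A := Algebra.lsmul K K E (X : K[X])) (B := A) (f := f) h p x
  rwa [Polynomial.aeval_algHom_apply, aeval_X_left_apply] at this

theorem aeval_conj_apply {V W : Type*} [AddCommGroup V] [Module K V] [AddCommGroup W]
    [Module K W] (e : V ≃ₗ[K] W) (A : Module.End K V) (p : K[X]) (w : W) :
    aeval (e.conj A) p w = e (aeval A p (e.symm w)) := by
  have := aeval_apply_of_semiconj (A := A) (B := e.conj A) (f := e.toLinearMap)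
    (fun v => by simp [LinearEquiv.conj_apply]) p (e.symm w)
  simpa using this.symm

theorem card_injective_linearMap [Finite K] {E V : Type*} [AddCommGroup E] [Module K E]
    [AddCommGroup V] [Module K V] [Module.Finite K V] [Module.Finite K E]
    (h : Module.finrank K E ≤ Module.finrank K V) :
    Nat.card {ψ : E →ₗ[K] V // Function.Injective ψ} =
      ∏ i ∈ Finset.range (Module.finrank K E),
        (Nat.card K ^ Module.finrank K V - Nat.card K ^ i) := by
  have := Fintype.ofFinite K
  have : Finite V := Module.finite_of_finite K
  have := Fintype.ofFinite V
  have b := Module.finBasis K E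
  have e : {s : Fin (Module.finrank K E) → V // LinearIndependent K s} ≃
      {ψ : E →ₗ[K] V // Function.Injective ψ} :=
    (b.constr K).toEquiv.subtypeEquiv fun s => by
      have : ⇑(b.constr K s) = Finsupp.linearCombination K s ∘ b.repr := by
        ext x
        simp [Module.Basis.constr_apply_fintype, Finsupp.linearCombination_apply,
          Finsupp.sum_fintype]
      change _ ↔ Function.Injective (b.constr K s)
      rw [this, Function.Injective.of_comp_iff' _ b.repr.bijective, LinearIndependent]
  rw [← Nat.card_congr e, card_linearIndependent h, Finset.prod_range, Nat.card_eq_fintype_card]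

variable {E V F : Type*} [AddCommGroup E] [Module K E] [Module K[X] E]
  [AddCommGroup V] [Module K V] [AddCommGroup F] [Module K F]

theorem IsRegularEmbedding.conj_iff {W : Type*} [AddCommGroup W] [Module K W] (P : K[X])
    (A : Module.End K V) (ψ : E →ₗ[K] V) (e : V ≃ₗ[K] W) :
    IsRegularEmbedding P (e.conj A) (e.toLinearMap ∘ₗ ψ) ↔ IsRegularEmbedding P A ψ := by
  constructor
  · rintro ⟨h1, h2, h3⟩
    refine ⟨?_, fun x => ?_, fun v ⟨x, hx⟩ => ?_⟩
    · exact Function.Injective.of_comp (f := e) h1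
    · apply e.injective
      simpa [LinearEquiv.conj_apply] using h2 x
    · obtain ⟨y, hy⟩ := h3 (e v) ⟨x, by simp [aeval_conj_apply, hx]⟩
      exact ⟨y, e.injective hy⟩
  · rintro ⟨h1, h2, h3⟩
    refine ⟨?_, fun x => ?_, fun v ⟨x, hx⟩ => ?_⟩
    · exact e.injective.comp h1
    · simp [LinearEquiv.conj_apply, h2]
    · rw [aeval_conj_apply] at hx
      obtain ⟨y, hy⟩ := h3 (e.symm v) ⟨x, e.injective hx⟩
      exact ⟨y, by simp [hy]⟩

/-- Such an A is block upper triangular, so the quotient by E is F with t acting through the lower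
right block, and so does P. -/
theorem isRegularEmbedding_inl_iff (P : K[X]) (A : Module.End K (E × F)) :
    IsRegularEmbedding P A (LinearMap.inl K E F) ↔
      (∀ x : E, A (x, 0) = ((X : K[X]) • x, 0)) ∧
      Function.Injective (aeval (LinearMap.snd K E F ∘ₗ A ∘ₗ LinearMap.inr K E F) P) := by
  have key : (∀ x : E, A (x, 0) = ((X : K[X]) • x, 0)) → ∀ v : E × F, (aeval A P v).2 =
      aeval (LinearMap.snd K E F ∘ₗ A ∘ₗ LinearMap.inr K E F) P v.2 := by
    intro h v
    refine aeval_apply_of_semiconj (f := LinearMap.snd K E F) (fun w => ?_) P v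
    have : w = (w.1, 0) + (0, w.2) := by simp
    conv_lhs => rw [this, map_add, h]
    simp
  constructor
  · rintro ⟨-, h2, h3⟩
    have h : ∀ x : E, A (x, 0) = ((X : K[X]) • x, 0) := fun x => (h2 x).symm
    refine ⟨h, (injective_iff_map_eq_zero _).2 fun w hw => ?_⟩
    obtain ⟨x, hx⟩ := h3 (0, w) ⟨(aeval A P (0, w)).1, by
      ext
      · rfl
      · rw [key h, hw]; rfl⟩
    exact (congrArg Prod.snd hx).symm
  · rintro ⟨h, hi⟩
    refine ⟨LinearMap.inl_injective, fun x => (h x).symm, ?_⟩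
    rintro v ⟨x, hx⟩
    have h0 : aeval (LinearMap.snd K E F ∘ₗ A ∘ₗ LinearMap.inr K E F) P v.2 = 0 := by
      rw [← key h, ← hx]; rfl
    have := (injective_iff_map_eq_zero _).1 hi _ h0
    exact ⟨v.1, by ext <;> simp [this]⟩

variable [IsScalarTower K K[X] E]

/-- Block triangular endomorphisms of `E × F` with the given diagonal block on `E`. -/
noncomputable def regularEmbeddingInlEquiv (P : K[X]) :
    {A : Module.End K (E × F) // IsRegularEmbedding P A (LinearMap.inl K E F)} ≃
      (F →ₗ[K] E) × {B : Module.End K F // Function.Injective (aeval B P)} where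
  toFun A := (LinearMap.fst K E F ∘ₗ A.1 ∘ₗ LinearMap.inr K E F,
    ⟨_, ((isRegularEmbedding_inl_iff P A.1).1 A.2).2⟩)
  invFun p := ⟨(LinearMap.inl K E F ∘ₗ Algebra.lsmul K K E (X : K[X])).coprod (p.1.prod p.2.1), by
    rw [isRegularEmbedding_inl_iff]
    refine ⟨fun x => by simp, ?_⟩
    convert p.2.2 using 3
    ext; simp⟩
  left_inv A := by
    have h := ((isRegularEmbedding_inl_iff P A.1).1 A.2).1
    ext x <;> simp [h]
  right_inv p := by
    ext x <;> simp

/-- A complement of the range of ψ turns ψ into the inclusion E → E × F. The off-diagonal block F →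
E is then free, which accounts for the power of |K|. -/
theorem card_regularEmbedding_fixed [Module.Finite K V] [Module.Finite K F] [Module.Finite K E]
    (P : K[X]) {ψ : E →ₗ[K] V} (hψ : Function.Injective ψ)
    (hF : Module.finrank K E + Module.finrank K F = Module.finrank K V) :
    Nat.card {A : Module.End K V // IsRegularEmbedding P A ψ} =
      Nat.card K ^ (Module.finrank K E * Module.finrank K F) * regularCount P F := by
  obtain ⟨W, hW⟩ := Submodule.exists_isCompl (LinearMap.range ψ)
  have hr : Module.finrank K (LinearMap.range ψ) = Module.finrank K E :=
    LinearMap.finrank_range_of_inj hψ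
  have hWF : Module.finrank K W = Module.finrank K F := by
    have := Submodule.finrank_add_eq_of_isCompl hW
    omega
  let e : V ≃ₗ[K] E × F := (Submodule.prodEquivOfIsCompl _ _ hW).symm.trans
    (LinearEquiv.prodCongr (LinearEquiv.ofInjective ψ hψ).symm (LinearEquiv.ofFinrankEq W F hWF))
  have he : e.toLinearMap ∘ₗ ψ = LinearMap.inl K E F := by
    ext1 x
    have : (Submodule.prodEquivOfIsCompl _ _ hW).symm (ψ x) =
        (LinearEquiv.ofInjective ψ hψ x, 0) := by
      rw [LinearEquiv.symm_apply_eq]; simp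
    simp [e, this]
  have e1 : {A : Module.End K V // IsRegularEmbedding P A ψ} ≃
      {A : Module.End K (E × F) // IsRegularEmbedding P A (LinearMap.inl K E F)} :=
    e.conj.toEquiv.subtypeEquiv fun A => by
      rw [← he]; exact (IsRegularEmbedding.conj_iff P A ψ e).symm
  rw [Nat.card_congr (e1.trans (regularEmbeddingInlEquiv P)), Nat.card_prod, regularCount,
    Module.natCard_eq_pow_finrank (K := K), Module.finrank_linearMap, mul_comm (Module.finrank K F)]

theorem card_regularEmbedding [Finite K] [Module.Finite K V] [Module.Finite K F] [Module.Finite K E]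
    (P : K[X]) (hF : Module.finrank K E + Module.finrank K F = Module.finrank K V) :
    Nat.card {p : Module.End K V × (E →ₗ[K] V) // IsRegularEmbedding P p.1 p.2} =
      (∏ i ∈ Finset.range (Module.finrank K E),
        (Nat.card K ^ Module.finrank K V - Nat.card K ^ i)) *
      (Nat.card K ^ (Module.finrank K E * Module.finrank K F) * regularCount P F) := by
  let e : {p : Module.End K V × (E →ₗ[K] V) // IsRegularEmbedding P p.1 p.2} ≃
      Σ ψ : {ψ : E →ₗ[K] V // Function.Injective ψ},
        {A : Module.End K V // IsRegularEmbedding P A ψ.1} :=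
    { toFun := fun p => ⟨⟨p.1.2, p.2.injective⟩, ⟨p.1.1, p.2⟩⟩
      invFun := fun s => ⟨(s.2.1, s.1.1), s.2.2⟩
      left_inv := fun _ => rfl
      right_inv := fun _ => rfl }
  have : Finite (E →ₗ[K] V) := Module.finite_of_finite K
  have : Finite (Module.End K V) := Module.finite_of_finite K
  have := Fintype.ofFinite {ψ : E →ₗ[K] V // Function.Injective ψ}
  rw [Nat.card_congr e, Nat.card_sigma,
    Finset.sum_congr rfl fun ψ _ => card_regularEmbedding_fixed (F := F) P ψ.2 hF,
    Finset.sum_const, Finset.card_univ, ← Nat.card_eq_fintype_card,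
    card_injective_linearMap (by omega), smul_eq_mul]

end Counting

/-! ### Regular embeddings of H and the P-power torsion of A. -/

section Torsion

variable {K : Type*} [Field K] {P : K[X]} {H V : Type*} [AddCommGroup H] [Module K H]
  [Module K[X] H] [IsScalarTower K K[X] H] [AddCommGroup V] [Module K V]

/-- Regular embeddings of a `P`-power torsion module `H` are the isomorphisms of `H` with the
`P`-power torsion submodule. -/
noncomputable def regularEmbeddingEquivTorsionIso (htors : Module.IsTorsion' H (Submonoid.powers P))
    (A : Module.End K V) :
    {ψ : H →ₗ[K] V // IsRegularEmbedding P A ψ} ≃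
      (H ≃ₗ[K[X]] primePowerTorsion K[X] (Module.AEval' A) P) where
  toFun ψ :=
    let φ : H →ₗ[K[X]] Module.AEval' A :=
      { toFun := fun x => Module.AEval'.of A (ψ.1 x)
        map_add' := by simp
        map_smul' := fun p x => by
          rw [map_smul_of_map_X_smul ψ.2.map_X_smul]; rfl }
    LinearEquiv.ofBijective (φ.codRestrict _ fun x => by
        obtain ⟨a, ha⟩ := @htors x
        rw [Submodule.mem_torsion'_iff]
        refine ⟨a, ?_⟩
        have := congrArg φ ha
        rw [map_zero] at this
        rw [← this]
        exact (φ.map_smul a.1 x).symm) <| by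
      constructor
      · intro x y hxy
        exact ψ.2.injective ((Module.AEval'.of A).injective (congrArg Subtype.val hxy))
      · rintro ⟨x, hx⟩
        -- Injectivity of P on the quotient, applied N times, puts every vector killed by P^N in the
        -- range.
        have hind : ∀ N (v : V), aeval A (P ^ N) v = 0 → v ∈ LinearMap.range ψ.1 := by
          intro N
          induction N with
          | zero => intro v hv; simp at hv; simp [hv]
          | succ N ih =>
            intro v hv
            exact ψ.2.mem_range v (ih _ (by simpa [pow_succ] using hv))
        obtain ⟨⟨a, N, rfl⟩, ha⟩ := (Submodule.mem_torsion'_iff _ x).1 hx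
        obtain ⟨y, hy⟩ := hind N ((Module.AEval'.of A).symm x) ha
        exact ⟨y, Subtype.ext (by simp [φ, hy])⟩
  invFun e := ⟨(Module.AEval'.of A).symm.toLinearMap ∘ₗ
      ((Submodule.subtype _).comp e.toLinearMap).restrictScalars K, by
    constructor
    · exact (Module.AEval'.of A).symm.injective.comp
        (Subtype.val_injective.comp e.injective)
    · intro x
      have : (e ((X : K[X]) • x) : Module.AEval' A) = (X : K[X]) • (e x : Module.AEval' A) := by
        rw [map_smul]; rfl
      simp
    · rintro v ⟨x, hx⟩
      have hx' : (e x : Module.AEval' A) = P • Module.AEval'.of A v := hx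
      -- If P v is killed by P^N then v is killed by P^(N+1), so P is injective modulo the torsion
      -- submodule.
      have hm : Module.AEval'.of A v ∈ primePowerTorsion K[X] (Module.AEval' A) P := by
        obtain ⟨⟨a, N, rfl⟩, ha⟩ := (Submodule.mem_torsion'_iff _ _).1 (e x).2
        rw [Submodule.mem_torsion'_iff]
        refine ⟨⟨P ^ (N + 1), N + 1, rfl⟩, ?_⟩
        rw [hx'] at ha
        change P ^ (N + 1) • _ = (0 : Module.AEval' A)
        rw [pow_succ, mul_smul]
        exact ha
      refine ⟨e.symm ⟨_, hm⟩, ?_⟩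
      simp⟩
  left_inv ψ := Subtype.ext (LinearMap.ext fun x =>
    (Module.AEval'.of A).symm_apply_apply (ψ.1 x))
  right_inv e := by ext x; simp

/-- The pairs are fibred over A: a fibre is the set of isomorphisms H → A[P^∞], and composing with
one of them identifies it with Aut H. -/
theorem card_isoTorsion_mul_card_aut [Finite K] [Module.Finite K H]
    (htors : Module.IsTorsion' H (Submonoid.powers P)) (n : ℕ) :
    Nat.card {A : Matrix (Fin n) (Fin n) K |
      Nonempty (primePowerTorsion K[X] (matrixModule A) P ≃ₗ[K[X]] H)} *
        Nat.card (H ≃ₗ[K[X]] H) =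
      Nat.card {p : Module.End K (Fin n → K) × (H →ₗ[K] (Fin n → K)) //
        IsRegularEmbedding P p.1 p.2} := by
  classical
  have := Fintype.ofFinite K
  have : Finite H := Module.finite_of_finite K
  have : Finite (H →ₗ[K] (Fin n → K)) := Module.finite_of_finite K
  let e : {p : Module.End K (Fin n → K) × (H →ₗ[K] (Fin n → K)) // IsRegularEmbedding P p.1 p.2} ≃
      Σ A : Matrix (Fin n) (Fin n) K, {ψ // IsRegularEmbedding P (Matrix.toLin' A) ψ} :=
    { toFun := fun p => ⟨LinearMap.toMatrix' p.1.1, ⟨p.1.2, by simpa using p.2⟩⟩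
      invFun := fun s => ⟨(Matrix.toLin' s.1, s.2.1), s.2.2⟩
      left_inv := fun p => by ext1; simp
      right_inv := fun s => by
        obtain ⟨A, ψ, hψ⟩ := s
        simp only [Sigma.mk.injEq, LinearMap.toMatrix'_toLin', true_and]
        congr!
        simp }
  have hcard (A : Matrix (Fin n) (Fin n) K) :
      Nat.card {ψ : H →ₗ[K] (Fin n → K) // IsRegularEmbedding P (Matrix.toLin' A) ψ} =
        if Nonempty (primePowerTorsion K[X] (matrixModule A) P ≃ₗ[K[X]] H) then
          Nat.card (H ≃ₗ[K[X]] H) else 0 := by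
    rw [Nat.card_congr (regularEmbeddingEquivTorsionIso htors _)]
    split_ifs with h
    · obtain ⟨f⟩ := h
      exact Nat.card_congr
        { toFun := fun g => g.trans f
          invFun := fun g => g.trans f.symm
          left_inv := fun g => by ext; simp
          right_inv := fun g => by ext; simp }
    · have : IsEmpty (H ≃ₗ[K[X]] primePowerTorsion K[X] (matrixModule A) P) :=
        ⟨fun g => h ⟨g.symm⟩⟩
      exact Nat.card_of_isEmpty
  rw [Nat.card_congr e, Nat.card_sigma, Finset.sum_congr rfl fun A _ => hcard A,
    ← Finset.sum_filter, Finset.sum_const, smul_eq_mul, Nat.card_eq_fintype_card,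
    Fintype.card_subtype]
  rfl

end Torsion

/-! ### Monic polynomials prime to P. -/

section Monic

variable {K : Type*} [Field K]

theorem card_monic_natDegree_eq (m : ℕ) :
    Nat.card {f : K[X] // f.Monic ∧ f.natDegree = m} = Nat.card K ^ m := by
  rw [Nat.card_congr ((monicEquivDegreeLT m).trans (degreeLTEquiv K m).toEquiv), Nat.card_fun]
  simp

variable [Finite K]

instance finite_monic_natDegree_eq (m : ℕ) :
    Finite {f : K[X] // f.Monic ∧ f.natDegree = m} :=
  Finite.of_equiv _ ((monicEquivDegreeLT m).trans (degreeLTEquiv K m).toEquiv).symm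

instance finite_monic_natDegree_eq_and (m : ℕ) (p : K[X] → Prop) :
    Finite {f : K[X] // (f.Monic ∧ f.natDegree = m) ∧ p f} :=
  Finite.of_injective (β := {f : K[X] // f.Monic ∧ f.natDegree = m}) (fun f => ⟨f.1, f.2.1⟩)
    fun f g h => Subtype.ext (by simpa using h)

/-- The number of monic polynomials of degree `m` that are not divisible by `P`. -/
noncomputable def coprimeMonicCount {K : Type*} [Field K] (P : K[X]) (m : ℕ) : ℕ :=
  Nat.card {f : K[X] // (f.Monic ∧ f.natDegree = m) ∧ ¬ P ∣ f}

/-- The second summand counts the monic multiples of P, through their monic cofactors. -/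
theorem coprimeMonicCount_add {P : K[X]} (hP : P.Monic) (m : ℕ) :
    coprimeMonicCount P m + (if P.natDegree ≤ m then Nat.card K ^ (m - P.natDegree) else 0) =
      Nat.card K ^ m := by
  classical
  have hdvd : Nat.card {f : K[X] // (f.Monic ∧ f.natDegree = m) ∧ P ∣ f} =
      if P.natDegree ≤ m then Nat.card K ^ (m - P.natDegree) else 0 := by
    split_ifs with h
    · rw [← card_monic_natDegree_eq (K := K), eq_comm]
      refine Nat.card_congr (Equiv.ofBijective (fun g => ⟨P * g.1, ⟨hP.mul g.2.1, ?_⟩,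
        dvd_mul_right _ _⟩) ⟨fun g g' hg => ?_, ?_⟩)
      · rw [hP.natDegree_mul g.2.1, g.2.2]; omega
      · exact Subtype.ext (mul_left_cancel₀ hP.ne_zero (congrArg Subtype.val hg))
      · rintro ⟨_, ⟨hf, hm⟩, ⟨g, rfl⟩⟩
        have hg : g.Monic := hP.of_mul_monic_left hf
        rw [hP.natDegree_mul hg] at hm
        exact ⟨⟨g, hg, by omega⟩, rfl⟩
    · have : IsEmpty {f : K[X] // (f.Monic ∧ f.natDegree = m) ∧ P ∣ f} := by
        refine ⟨fun ⟨f, ⟨hf, hm⟩, hd⟩ => h ?_⟩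
        rw [← hm]
        exact natDegree_le_of_dvd hd hf.ne_zero
      exact Nat.card_of_isEmpty
  rw [← hdvd, ← card_monic_natDegree_eq, coprimeMonicCount, ← Nat.card_sum]
  refine Nat.card_congr (Equiv.trans (Equiv.sumCongr
    (Equiv.subtypeSubtypeEquivSubtypeInter _ _).symm
    (Equiv.subtypeSubtypeEquivSubtypeInter _ _).symm)
    ((Equiv.sumComm _ _).trans
    (Equiv.sumCompl fun f : {f : K[X] // f.Monic ∧ f.natDegree = m} => P ∣ f.1)))

end Monic

/-! ### Cyclic submodules and the recursion for `regularCount`. -/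

section Cyclic

variable {K V : Type*} [Field K] [AddCommGroup V] [Module K V]

/-- The annihilator of v is principal, and nonzero because it contains the minimal polynomial of A.
-/
theorem exists_monic_aeval_apply_eq_zero_iff [Module.Finite K V] (A : Module.End K V) (v : V) :
    ∃ f : K[X], f.Monic ∧ ∀ p : K[X], aeval A p v = 0 ↔ f ∣ p := by
  classical
  let I : Ideal K[X] := LinearMap.ker (LinearMap.toSpanSingleton K[X] (Module.AEval' A)
    (Module.AEval'.of A v))
  have hI : ∀ p, p ∈ I ↔ aeval A p v = 0 := fun p => Iff.rfl
  have hI0 : Submodule.IsPrincipal.generator I ≠ 0 := by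
    intro h0
    have h1 : minpoly K A ∈ I := by rw [hI, minpoly.aeval]; rfl
    rw [Submodule.IsPrincipal.mem_iff_generator_dvd, h0, zero_dvd_iff] at h1
    exact minpoly.ne_zero (Algebra.IsIntegral.isIntegral A) h1
  refine ⟨normalize (Submodule.IsPrincipal.generator I), monic_normalize hI0, fun p => ?_⟩
  rw [← hI, Submodule.IsPrincipal.mem_iff_generator_dvd, normalize_dvd_iff]

theorem smul_quotient_mk (I : Ideal K[X]) (p g : K[X]) :
    p • Ideal.Quotient.mk I g = Ideal.Quotient.mk I (p * g) := rfl

theorem smul_quotient_one (I : Ideal K[X]) (p : K[X]) :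
    p • (1 : K[X] ⧸ I) = Ideal.Quotient.mk I p := by
  rw [← map_one (Ideal.Quotient.mk I), smul_quotient_mk, mul_one]

/-- The image of `1` under an embedding of the cyclic module `K[t]/(f)` has annihilator `(f)`. -/
theorem IsRegularEmbedding.aeval_apply_one_eq_zero_iff {P f : K[X]} {A : Module.End K V}
    {ψ : (K[X] ⧸ Ideal.span {f}) →ₗ[K] V} (h : IsRegularEmbedding P A ψ) (p : K[X]) :
    aeval A p (ψ 1) = 0 ↔ f ∣ p := by
  rw [← map_smul_of_map_X_smul h.map_X_smul, map_eq_zero_iff _ h.injective, smul_quotient_one,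
    Ideal.Quotient.eq_zero_iff_mem, Ideal.mem_span_singleton]

theorem IsRegularEmbedding.eq_of_apply_one_eq {P f : K[X]} {A : Module.End K V}
    {ψ ψ' : (K[X] ⧸ Ideal.span {f}) →ₗ[K] V} (h : IsRegularEmbedding P A ψ)
    (h' : IsRegularEmbedding P A ψ') (h1 : ψ 1 = ψ' 1) : ψ = ψ' := by
  refine LinearMap.ext fun x => ?_
  obtain ⟨p, rfl⟩ := Ideal.Quotient.mk_surjective x
  rw [← smul_quotient_one, map_smul_of_map_X_smul h.map_X_smul,
    map_smul_of_map_X_smul h'.map_X_smul, h1]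

theorem IsRegularEmbedding.polynomial_eq_of_apply_one_eq {P f f' : K[X]} (hf : f.Monic)
    (hf' : f'.Monic) {A : Module.End K V} {ψ : (K[X] ⧸ Ideal.span {f}) →ₗ[K] V}
    {ψ' : (K[X] ⧸ Ideal.span {f'}) →ₗ[K] V} (h : IsRegularEmbedding P A ψ)
    (h' : IsRegularEmbedding P A ψ') (h1 : ψ 1 = ψ' 1) : f = f' := by
  refine eq_of_monic_of_associated hf hf' (associated_of_dvd_dvd ?_ ?_)
  · rw [← h.aeval_apply_one_eq_zero_iff, h1, h'.aeval_apply_one_eq_zero_iff]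
  · rw [← h'.aeval_apply_one_eq_zero_iff, ← h1, h.aeval_apply_one_eq_zero_iff]

/-- P is injective on the quotient by hypothesis, and on K[t]/(f) because it is prime to f; hence on
all of V. -/
theorem IsRegularEmbedding.injective_aeval {P f : K[X]} (hP : Irreducible P) (hPf : ¬ P ∣ f)
    {A : Module.End K V} {ψ : (K[X] ⧸ Ideal.span {f}) →ₗ[K] V} (h : IsRegularEmbedding P A ψ) :
    Function.Injective (aeval A P) := by
  refine (injective_iff_map_eq_zero _).2 fun v hv => ?_
  obtain ⟨x, rfl⟩ := h.mem_range v (by rw [hv]; exact zero_mem _)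
  obtain ⟨p, rfl⟩ := Ideal.Quotient.mk_surjective x
  rw [← map_smul_of_map_X_smul h.map_X_smul, map_eq_zero_iff _ h.injective] at hv
  rw [map_eq_zero_iff _ h.injective]
  rw [smul_quotient_mk, Ideal.Quotient.eq_zero_iff_mem, Ideal.mem_span_singleton] at hv
  rw [Ideal.Quotient.eq_zero_iff_mem, Ideal.mem_span_singleton]
  exact ((hP.coprime_iff_not_dvd.2 hPf).symm).dvd_of_dvd_mul_left hv

theorem exists_isRegularEmbedding_apply_one {P f : K[X]} (hP : Irreducible P) (hf : f.Monic)
    {A : Module.End K V} (hA : Function.Injective (aeval A P)) {v : V}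
    (hv : ∀ p : K[X], aeval A p v = 0 ↔ f ∣ p) :
    ¬ P ∣ f ∧ ∃ ψ : (K[X] ⧸ Ideal.span {f}) →ₗ[K] V, IsRegularEmbedding P A ψ ∧ ψ 1 = v := by
  -- If f = P g, injectivity of P(A) gives g(A) v = 0, so P g divides g and P would be a unit.
  have hPf : ¬ P ∣ f := by
    rintro ⟨g, rfl⟩
    have h1 : aeval A (P * g) v = 0 := (hv _).2 dvd_rfl
    rw [map_mul, Module.End.mul_apply, map_eq_zero_iff _ hA, hv] at h1
    have hg : g ≠ 0 := right_ne_zero_of_mul hf.ne_zero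
    obtain ⟨c, hc⟩ := h1
    refine hP.not_isUnit (IsUnit.of_mul_eq_one c (mul_right_cancel₀ hg ?_))
    rw [one_mul]
    linear_combination -hc
  refine ⟨hPf, ?_⟩
  let φ : (K[X] ⧸ Ideal.span {f}) →ₗ[K[X]] Module.AEval' A :=
    (Ideal.span {f}).liftQ (LinearMap.toSpanSingleton K[X] (Module.AEval' A)
      (Module.AEval'.of A v)) fun p hp => (hv p).2 (Ideal.mem_span_singleton.1 hp)
  let ψ : (K[X] ⧸ Ideal.span {f}) →ₗ[K] V :=
    (Module.AEval'.of A).symm.toLinearMap ∘ₗ φ.restrictScalars K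
  have hψ : ∀ p, ψ (Ideal.Quotient.mk _ p) = aeval A p v := fun p => rfl
  have hX : ∀ x, ψ ((X : K[X]) • x) = A (ψ x) := by
    intro x
    obtain ⟨p, rfl⟩ := Ideal.Quotient.mk_surjective x
    rw [smul_quotient_mk, hψ, hψ]
    simp
  refine ⟨ψ, ⟨?_, hX, ?_⟩, ?_⟩
  · refine (injective_iff_map_eq_zero _).2 fun x hx => ?_
    obtain ⟨p, rfl⟩ := Ideal.Quotient.mk_surjective x
    rw [hψ, hv] at hx
    rwa [Ideal.Quotient.eq_zero_iff_mem, Ideal.mem_span_singleton]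
  · rintro w ⟨x, hx⟩
    -- With u P + c f = 1, P acts invertibly on the span of v, with inverse u. So P(A) w = p(A) v
    -- forces w = (u p)(A) v.
    obtain ⟨u, c, huc⟩ := hP.coprime_iff_not_dvd.2 hPf
    obtain ⟨p, rfl⟩ := Ideal.Quotient.mk_surjective x
    refine ⟨Ideal.Quotient.mk _ (u * p), hA ?_⟩
    rw [← hx, hψ, hψ, ← Module.End.mul_apply, ← map_mul, ← sub_eq_zero, ← LinearMap.sub_apply,
      ← map_sub, hv]
    exact ⟨-c * p, by linear_combination p * huc⟩
  · have := hψ 1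
    rw [map_one] at this
    simp [this]

/-- Both sides count pairs (B, v) with P(B) injective. On the right they are sorted by the degree m
of the annihilator f of v; each f contributes the regular embeddings of K[t]/(f), whose number
depends only on m. -/
theorem regularCount_mul_card [Finite K] [Module.Finite K V] {P : K[X]} (hP : Irreducible P) :
    regularCount P V * Nat.card V =
      ∑ m ∈ Finset.range (Module.finrank K V + 1), coprimeMonicCount P m *
        ((∏ i ∈ Finset.range m, (Nat.card K ^ Module.finrank K V - Nat.card K ^ i)) *
        (Nat.card K ^ (m * (Module.finrank K V - m)) *
          regularCount P (Fin (Module.finrank K V - m) → K))) := by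
  set n := Module.finrank K V with hn
  have hfin : Finite V := Module.finite_of_finite K
  have : Finite (Module.End K V) := Module.finite_of_finite K
  let T (m : ℕ) := {f : K[X] // (f.Monic ∧ f.natDegree = m) ∧ ¬ P ∣ f}
  let R (f : K[X]) := {p : Module.End K V × ((K[X] ⧸ Ideal.span {f}) →ₗ[K] V) //
    IsRegularEmbedding P p.1 p.2}
  let G : (Σ m : Fin (n + 1), Σ f : T m, R f.1) →
      {B : Module.End K V // Function.Injective (aeval B P)} × V :=
    fun s => (⟨s.2.2.1.1, s.2.2.2.injective_aeval hP s.2.1.2.2⟩, s.2.2.1.2 1)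
  have hG : Function.Bijective G := by
    constructor
    · rintro ⟨m, ⟨f, ⟨hf, hm⟩, hPf⟩, ⟨A, ψ⟩, h⟩ ⟨m', ⟨f', ⟨hf', hm'⟩, hPf'⟩, ⟨A', ψ'⟩, h'⟩ hG
      simp only [G, Prod.mk.injEq, Subtype.mk.injEq] at hG h h'
      obtain ⟨rfl, hv⟩ := hG
      obtain rfl := h.polynomial_eq_of_apply_one_eq hf hf' h' hv
      obtain rfl : m = m' := Fin.ext (hm.symm.trans hm')
      obtain rfl := h.eq_of_apply_one_eq h' hv
      rfl
    · rintro ⟨⟨A, hA⟩, v⟩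
      obtain ⟨f, hf, hfv⟩ := exists_monic_aeval_apply_eq_zero_iff A v
      obtain ⟨hPf, ψ, hψ, h1⟩ := exists_isRegularEmbedding_apply_one hP hf hA hfv
      have hdeg : f.natDegree ≤ n := by
        rw [← finrank_quotient_span_eq_natDegree]
        exact LinearMap.finrank_le_finrank_of_injective hψ.injective
      exact ⟨⟨⟨f.natDegree, by omega⟩, ⟨f, ⟨hf, rfl⟩, hPf⟩, (A, ψ), hψ⟩, by simp [G, h1]⟩
  have hR (m : ℕ) (hm : m ≤ n) (f : T m) : Nat.card (R f.1) =
      (∏ i ∈ Finset.range m, (Nat.card K ^ n - Nat.card K ^ i)) *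
        (Nat.card K ^ (m * (n - m)) * regularCount P (Fin (n - m) → K)) := by
    have hd : Module.finrank K (K[X] ⧸ Ideal.span {f.1}) = m := by
      rw [finrank_quotient_span_eq_natDegree, f.2.1.2]
    have : Module.Finite K (K[X] ⧸ Ideal.span {f.1}) := f.2.1.1.finite_quotient
    have := card_regularEmbedding (K := K) (E := K[X] ⧸ Ideal.span {f.1}) (V := V)
      (F := Fin (n - m) → K) P (by simp [hd]; omega)
    rw [this, hd]
    simp [← hn]
  have (m : ℕ) : Fintype (T m) := Fintype.ofFinite _
  have hRfin (m : ℕ) (f : T m) : Finite (R f.1) := by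
    have : Module.Finite K (K[X] ⧸ Ideal.span {f.1}) := f.2.1.1.finite_quotient
    have : Finite ((K[X] ⧸ Ideal.span {f.1}) →ₗ[K] V) := Module.finite_of_finite K
    exact Subtype.finite
  rw [regularCount, ← Nat.card_prod, ← Nat.card_congr (Equiv.ofBijective G hG), Nat.card_sigma,
    Finset.sum_range]
  refine Finset.sum_congr rfl fun m _ => ?_
  rw [Nat.card_sigma, Finset.sum_congr rfl fun f _ => hR m (by omega) f, Finset.sum_const,
    Finset.card_univ, ← Nat.card_eq_fintype_card, smul_eq_mul, coprimeMonicCount]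

end Cyclic

/-! ### Convergence of infinite products of power series. -/

section CoefficientNorm

variable {R : Type*} [NormedCommRing R]

/-- The sum of the norms of the coefficients of degree at most `n`. -/
noncomputable def truncNorm (n : ℕ) (f : R⟦X⟧) : ℝ :=
  ∑ k ∈ Finset.range (n + 1), ‖PowerSeries.coeff k f‖

theorem truncNorm_nonneg (n : ℕ) (f : R⟦X⟧) : 0 ≤ truncNorm n f :=
  Finset.sum_nonneg fun _ _ => norm_nonneg _

theorem norm_coeff_le_truncNorm (n : ℕ) (f : R⟦X⟧) : ‖PowerSeries.coeff n f‖ ≤ truncNorm n f :=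
  Finset.single_le_sum (f := fun k => ‖PowerSeries.coeff k f‖) (fun _ _ => norm_nonneg _)
    (Finset.self_mem_range_succ n)

theorem truncNorm_one [NormOneClass R] (n : ℕ) : truncNorm n (1 : R⟦X⟧) = 1 := by
  rw [truncNorm, Finset.sum_eq_single 0]
  · simp
  · intro k _ hk; simp [PowerSeries.coeff_one, hk]
  · simp

/-- The antidiagonals of index at most n are disjoint and lie in the square [0, n]². -/
theorem truncNorm_mul_le (n : ℕ) (f g : R⟦X⟧) :
    truncNorm n (f * g) ≤ truncNorm n f * truncNorm n g := by
  classical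
  let F : ℕ × ℕ → ℝ := fun p => ‖PowerSeries.coeff p.1 f‖ * ‖PowerSeries.coeff p.2 g‖
  have hF : ∀ p, 0 ≤ F p := fun p => by positivity
  calc truncNorm n (f * g)
      ≤ ∑ k ∈ Finset.range (n + 1), ∑ p ∈ Finset.HasAntidiagonal.antidiagonal k, F p := by
        refine Finset.sum_le_sum fun k _ => ?_
        rw [PowerSeries.coeff_mul]
        exact (norm_sum_le _ _).trans (Finset.sum_le_sum fun p _ => norm_mul_le _ _)
    _ ≤ ∑ p ∈ Finset.range (n + 1) ×ˢ Finset.range (n + 1), F p := by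
        refine le_trans (Finset.sum_le_sum fun k hk => ?_)
          (Finset.sum_fiberwise_le_sum_of_sum_fiber_nonneg (g := fun p : ℕ × ℕ => p.1 + p.2)
            (t := Finset.range (n + 1)) fun k _ => Finset.sum_nonneg fun p _ => hF p)
        refine Finset.sum_le_sum_of_subset_of_nonneg (fun p hp => ?_) fun p _ _ => hF p
        simp only [Finset.HasAntidiagonal.mem_antidiagonal, Finset.mem_range, Finset.mem_filter,
          Finset.mem_product] at hp hk ⊢
        omega
    _ = truncNorm n f * truncNorm n g := by
        rw [truncNorm, truncNorm, Finset.sum_mul_sum, Finset.sum_product]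

theorem truncNorm_prod_le [NormOneClass R] {ι : Type*} (n : ℕ) (s : Finset ι) (f : ι → R⟦X⟧) :
    truncNorm n (∏ i ∈ s, f i) ≤ ∏ i ∈ s, truncNorm n (f i) := by
  classical
  induction s using Finset.induction_on with
  | empty => simp [truncNorm_one]
  | insert i s hi ih =>
    rw [Finset.prod_insert hi, Finset.prod_insert hi]
    exact (truncNorm_mul_le _ _ _).trans (mul_le_mul_of_nonneg_left ih (truncNorm_nonneg _ _))

/-- Expanding the product gives a sum over finite subsets. By submultiplicativity of `truncNorm n`,
its n-th coefficients are dominated by finite products of a summable family of reals. -/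
theorem PowerSeries.multipliable_one_add_of_summable_truncNorm [NormOneClass R] [CompleteSpace R]
    {ι : Type*} {f : ι → R⟦X⟧} (h : ∀ n, Summable fun i => truncNorm n (f i)) :
    Multipliable fun i => 1 + f i := by
  refine multipliable_one_add_of_summable_prod ?_
  rw [PowerSeries.WithPiTopology.summable_iff_summable_coeff]
  intro n
  refine Summable.of_norm_bounded (summable_finsetProd_of_summable_nonneg
    (fun i => truncNorm_nonneg n (f i)) (h n)) fun s => ?_
  exact (norm_coeff_le_truncNorm _ _).trans (truncNorm_prod_le _ _ _)

theorem PowerSeries.continuous_rescale (a : R) :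
    Continuous (PowerSeries.rescale a : R⟦X⟧ →+* R⟦X⟧) := by
  rw [continuous_iff_continuousAt]
  intro f
  rw [ContinuousAt, PowerSeries.WithPiTopology.tendsto_iff_coeff_tendsto]
  intro n
  simp only [PowerSeries.coeff_rescale]
  exact ((PowerSeries.WithPiTopology.continuous_coeff R n).tendsto f).const_mul _

end CoefficientNorm

/-! ### The infinite product and its functional equation. -/

section BFactor

variable {q d : ℕ}

theorem bFactor_mul (q d j : ℕ) :
    bFactor q d j * (1 - PowerSeries.C ((q : ℂ)⁻¹ ^ j) * PowerSeries.X) =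
      1 - (PowerSeries.C ((q : ℂ)⁻¹ ^ (j + 1)) * PowerSeries.X) ^ d := by
  rw [bFactor, mul_assoc, PowerSeries.inv_mul_cancel _ (by simp), mul_one]

theorem eq_bFactor_of_mul_eq {j : ℕ} {F : ℂ⟦X⟧}
    (h : F * (1 - PowerSeries.C ((q : ℂ)⁻¹ ^ j) * PowerSeries.X) =
      1 - (PowerSeries.C ((q : ℂ)⁻¹ ^ (j + 1)) * PowerSeries.X) ^ d) : F = bFactor q d j := by
  rwa [bFactor, PowerSeries.eq_mul_inv_iff_mul_eq (by simp)]

theorem rescale_bFactor (q d j : ℕ) :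
    PowerSeries.rescale (q : ℂ)⁻¹ (bFactor q d j) = bFactor q d (j + 1) := by
  refine eq_bFactor_of_mul_eq ?_
  have := congrArg (PowerSeries.rescale (q : ℂ)⁻¹) (bFactor_mul q d j)
  have hC (x : ℂ) : PowerSeries.rescale (q : ℂ)⁻¹ (PowerSeries.C x * PowerSeries.X) =
      PowerSeries.C (x * (q : ℂ)⁻¹) * PowerSeries.X := by
    ext n
    rw [PowerSeries.coeff_rescale, PowerSeries.coeff_C_mul, PowerSeries.coeff_C_mul,
      PowerSeries.coeff_X]
    split_ifs with hn
    · rw [hn]; ring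
    · simp
  rwa [map_mul, map_sub, map_one, hC, ← pow_succ, map_sub, map_one,
    map_pow (PowerSeries.rescale (q : ℂ)⁻¹), hC, ← pow_succ] at this

theorem coeff_bFactor (q d j k : ℕ) :
    PowerSeries.coeff k (bFactor q d j) = ((q : ℂ)⁻¹ ^ j) ^ k -
      if d ≤ k then ((q : ℂ)⁻¹ ^ (j + 1)) ^ d * ((q : ℂ)⁻¹ ^ j) ^ (k - d) else 0 := by
  have : bFactor q d j = (1 - (PowerSeries.C ((q : ℂ)⁻¹ ^ (j + 1)) * PowerSeries.X) ^ d) *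
      PowerSeries.mk fun n => ((q : ℂ)⁻¹ ^ j) ^ n := by
    refine (eq_bFactor_of_mul_eq ?_).symm
    rw [mul_assoc]
    convert mul_one _
    ext n
    rw [mul_sub, mul_one, mul_left_comm, map_sub, PowerSeries.coeff_C_mul, PowerSeries.coeff_mk]
    cases n with
    | zero => simp
    | succ n =>
      rw [PowerSeries.coeff_succ_mul_X, PowerSeries.coeff_mk, PowerSeries.coeff_one]
      simp [pow_succ']
  rw [this, sub_mul, one_mul, map_sub, PowerSeries.coeff_mk, mul_pow, ← map_pow, mul_assoc,
    PowerSeries.coeff_C_mul, PowerSeries.coeff_X_pow_mul']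
  split_ifs <;> simp

theorem bFactor_zero_right (q j : ℕ) : bFactor q 0 j = 0 := by simp [bFactor]

theorem norm_inv_natCast (q : ℕ) : ‖(q : ℂ)⁻¹‖ = (q : ℝ)⁻¹ := by simp

theorem inv_natCast_le_half (hq : 1 < q) : (q : ℝ)⁻¹ ≤ 1 / 2 := by
  rw [one_div]
  exact inv_anti₀ (by norm_num) (by exact_mod_cast hq)

theorem summable_inv_pow (hq : 1 < q) : Summable fun j : ℕ => (q : ℝ)⁻¹ ^ j :=
  summable_geometric_of_lt_one (by positivity) (by linarith [inv_natCast_le_half hq])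

theorem truncNorm_bFactor_sub_one_le (hq : 1 < q) (hd : 0 < d) (n j : ℕ) :
    truncNorm n (bFactor q d j - 1) ≤ (n + 1) * (2 * (q : ℝ)⁻¹ ^ j) := by
  have h0 : (0 : ℝ) ≤ (q : ℝ)⁻¹ := by positivity
  have h1 : (q : ℝ)⁻¹ ≤ 1 := by linarith [inv_natCast_le_half hq]
  have key : ∀ k, ‖PowerSeries.coeff k (bFactor q d j - 1)‖ ≤ 2 * (q : ℝ)⁻¹ ^ j := by
    intro k
    rw [map_sub, coeff_bFactor, PowerSeries.coeff_one]
    rcases Nat.eq_zero_or_pos k with rfl | hk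
    · simp [hd.ne']
    · rw [if_neg hk.ne', sub_zero]
      have hle : ((q : ℝ)⁻¹ ^ j) ^ k ≤ (q : ℝ)⁻¹ ^ j :=
        pow_le_of_le_one (by positivity) (pow_le_one₀ h0 h1) hk.ne'
      refine (norm_sub_le _ _).trans ?_
      rw [two_mul]
      refine add_le_add (by simpa [norm_pow] using hle) ?_
      split_ifs
      · rw [norm_mul, norm_pow, norm_pow, norm_pow, norm_pow, norm_inv_natCast]
        calc ((q : ℝ)⁻¹ ^ (j + 1)) ^ d * ((q : ℝ)⁻¹ ^ j) ^ (k - d)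
            ≤ ((q : ℝ)⁻¹ ^ (j + 1)) ^ d * 1 := by
              gcongr
              exact pow_le_one₀ (by positivity) (pow_le_one₀ h0 h1)
          _ ≤ (q : ℝ)⁻¹ ^ (j + 1) := by
              rw [mul_one]
              exact pow_le_of_le_one (by positivity) (pow_le_one₀ h0 h1) hd.ne'
          _ ≤ (q : ℝ)⁻¹ ^ j := pow_le_pow_of_le_one h0 h1 (Nat.le_succ j)
      · simp
  calc truncNorm n (bFactor q d j - 1) ≤ ∑ k ∈ Finset.range (n + 1), 2 * (q : ℝ)⁻¹ ^ j :=
        Finset.sum_le_sum fun k _ => key k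
    _ = _ := by simp

/-- This serves d = 0, where every factor vanishes because a zeroth power is 1. -/
theorem hasProd_fun_zero {M : Type*} [CommMonoidWithZero M] [TopologicalSpace M] :
    HasProd (fun _ : ℕ => (0 : M)) 0 := by
  refine tendsto_const_nhds.congr' ?_
  filter_upwards [eventually_ge_atTop ({0} : Finset ℕ)] with s hs
  exact (Finset.prod_eq_zero (hs (Finset.mem_singleton_self 0)) rfl).symm

theorem multipliable_bFactor (hq : 1 < q) (d : ℕ) : Multipliable (bFactor q d) := by
  rcases Nat.eq_zero_or_pos d with rfl | hd
  · have : bFactor q 0 = fun _ => 0 := funext (bFactor_zero_right q)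
    rw [this]
    exact hasProd_fun_zero.multipliable
  · have : bFactor q d = fun j => 1 + (bFactor q d j - 1) := by ext1 j; ring
    rw [this]
    refine PowerSeries.multipliable_one_add_of_summable_truncNorm fun n => ?_
    exact Summable.of_nonneg_of_le (fun j => truncNorm_nonneg _ _)
      (fun j => truncNorm_bFactor_sub_one_le hq hd n j)
      (((summable_inv_pow hq).mul_left 2).mul_left _)

/-- The functional equation `B(u) = (1 - (u/q)^d) / (1 - u) * B(u/q)` of the infinite product. -/
theorem tprod_bFactor_eq (hq : 1 < q) (d : ℕ) :
    ∏' j, bFactor q d j =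
      bFactor q d 0 * PowerSeries.rescale (q : ℂ)⁻¹ (∏' j, bFactor q d j) := by
  have hmap := (multipliable_bFactor hq d).map_tprod (PowerSeries.rescale (q : ℂ)⁻¹)
    (PowerSeries.continuous_rescale _)
  have hm := (multipliable_bFactor hq d).map (PowerSeries.rescale (q : ℂ)⁻¹)
    (PowerSeries.continuous_rescale _)
  have hs : (PowerSeries.rescale (q : ℂ)⁻¹) ∘ bFactor q d = fun j => bFactor q d (j + 1) :=
    funext (rescale_bFactor q d)
  rw [hs] at hm
  simp only [rescale_bFactor] at hmap
  rw [hmap]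
  exact tprod_eq_zero_mul' hm

theorem constantCoeff_tprod_bFactor (hq : 1 < q) (hd : 0 < d) :
    PowerSeries.constantCoeff (∏' j, bFactor q d j) = 1 := by
  rw [(multipliable_bFactor hq d).map_tprod (PowerSeries.constantCoeff (R := ℂ))
    (PowerSeries.WithPiTopology.continuous_constantCoeff ℂ)]
  have : ∀ j, PowerSeries.constantCoeff (bFactor q d j) = 1 := by
    intro j
    rw [← PowerSeries.coeff_zero_eq_constantCoeff_apply, coeff_bFactor]
    simp [hd.ne']
  simp [this]

theorem one_sub_X_mul_eq {B : ℂ⟦X⟧}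
    (h : B = bFactor q d 0 * PowerSeries.rescale (q : ℂ)⁻¹ B) :
    (1 - PowerSeries.X) * B =
      (1 - (PowerSeries.C (q : ℂ)⁻¹ * PowerSeries.X) ^ d) * PowerSeries.rescale (q : ℂ)⁻¹ B := by
  have := bFactor_mul q d 0
  simp only [pow_zero, map_one, one_mul, zero_add, pow_one] at this
  conv_lhs => rw [h]
  rw [← this]
  ring

theorem coeff_one_sub_C_mul_X_pow_mul (c : ℂ) (d n : ℕ) (F : ℂ⟦X⟧) :
    PowerSeries.coeff n ((1 - (PowerSeries.C c * PowerSeries.X) ^ d) * F) =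
      PowerSeries.coeff n F - if d ≤ n then c ^ d * PowerSeries.coeff (n - d) F else 0 := by
  rw [sub_mul, one_mul, map_sub, mul_pow, ← map_pow, mul_assoc,
    PowerSeries.coeff_C_mul, PowerSeries.coeff_X_pow_mul']
  split_ifs <;> simp

/-- The recursion for the coefficients of a solution of the functional equation. -/
theorem coeff_succ_of_functionalEquation {B : ℂ⟦X⟧}
    (h : B = bFactor q d 0 * PowerSeries.rescale (q : ℂ)⁻¹ B) (n : ℕ) :
    (1 - (q : ℂ)⁻¹ ^ (n + 1)) * PowerSeries.coeff (n + 1) B = PowerSeries.coeff n B -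
      if d ≤ n + 1 then (q : ℂ)⁻¹ ^ (n + 1) * PowerSeries.coeff (n + 1 - d) B else 0 := by
  have h1 := congrArg (PowerSeries.coeff (n + 1)) (one_sub_X_mul_eq h)
  rw [coeff_one_sub_C_mul_X_pow_mul, sub_mul, one_mul, map_sub, PowerSeries.coeff_succ_X_mul,
    PowerSeries.coeff_rescale, PowerSeries.coeff_rescale] at h1
  split_ifs at h1 ⊢ with hd
  · rw [← mul_assoc, ← pow_add, Nat.add_sub_cancel' hd] at h1
    linear_combination h1
  · linear_combination h1

theorem one_sub_inv_pow_succ_ne_zero (hq : 1 < q) (n : ℕ) : 1 - (q : ℂ)⁻¹ ^ (n + 1) ≠ 0 := by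
  rw [sub_ne_zero]
  intro h
  have h1 := congrArg norm h
  rw [norm_one, norm_pow, norm_inv_natCast] at h1
  have := pow_lt_one₀ (n := n + 1) (by positivity : (0 : ℝ) ≤ (q : ℝ)⁻¹)
    (by linarith [inv_natCast_le_half hq]) (by simp)
  linarith

/-- The recursion determines each coefficient from earlier ones: 1 - q^(-(n+1)) is nonzero, and d >
0 makes n + 1 - d smaller than n + 1. -/
theorem functionalEquation_unique (hq : 1 < q) (hd : 0 < d) {B B' : ℂ⟦X⟧}
    (h : B = bFactor q d 0 * PowerSeries.rescale (q : ℂ)⁻¹ B)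
    (h' : B' = bFactor q d 0 * PowerSeries.rescale (q : ℂ)⁻¹ B')
    (h0 : PowerSeries.coeff 0 B = PowerSeries.coeff 0 B') : B = B' := by
  ext n
  induction n using Nat.strong_induction_on with
  | _ n ih =>
    cases n with
    | zero => exact h0
    | succ n =>
      refine mul_left_cancel₀ (one_sub_inv_pow_succ_ne_zero hq n) ?_
      rw [coeff_succ_of_functionalEquation h, coeff_succ_of_functionalEquation h',
        ih n (by omega), ih (n + 1 - d) (by omega)]

theorem tprod_bFactor_eq_of_functionalEquation (hq : 1 < q) (hd : 0 < d) {B : ℂ⟦X⟧}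
    (h : B = bFactor q d 0 * PowerSeries.rescale (q : ℂ)⁻¹ B)
    (h0 : PowerSeries.coeff 0 B = 1) : ∏' j, bFactor q d j = B := by
  refine functionalEquation_unique hq hd (tprod_bFactor_eq hq d) h ?_
  rw [h0, PowerSeries.coeff_zero_eq_constantCoeff_apply, constantCoeff_tprod_bFactor hq hd]

end BFactor

/-! ### The limit of the coefficients. -/

section Limit

variable {q d : ℕ}

/-- With x = q^(-(n+1)), the recursion multiplies the bound by at most (1 + x)/(1 - x) ≤ 1 + 4x ≤
exp(4x). -/
theorem norm_coeff_le_exp (hq : 1 < q) (hd : 0 < d) {B : ℂ⟦X⟧}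
    (h : B = bFactor q d 0 * PowerSeries.rescale (q : ℂ)⁻¹ B)
    (h0 : PowerSeries.coeff 0 B = 1) (n : ℕ) :
    ‖PowerSeries.coeff n B‖ ≤ Real.exp (4 * ∑ i ∈ Finset.range n, (q : ℝ)⁻¹ ^ (i + 1)) := by
  have hmono : ∀ m n, m ≤ n → Real.exp (4 * ∑ i ∈ Finset.range m, (q : ℝ)⁻¹ ^ (i + 1)) ≤
      Real.exp (4 * ∑ i ∈ Finset.range n, (q : ℝ)⁻¹ ^ (i + 1)) := by
    intro m n hmn
    gcongr
  induction n using Nat.strong_induction_on with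
  | _ n ih =>
    cases n with
    | zero => simp [h0]
    | succ n =>
      set x : ℝ := (q : ℝ)⁻¹ ^ (n + 1) with hx
      set M := Real.exp (4 * ∑ i ∈ Finset.range n, (q : ℝ)⁻¹ ^ (i + 1)) with hM
      have hM0 : 0 < M := Real.exp_pos _
      have hx0 : 0 ≤ x := by positivity
      have hx1 : x ≤ 1 / 2 := (pow_le_of_le_one (by positivity)
        (by linarith [inv_natCast_le_half hq]) (by simp)).trans (inv_natCast_le_half hq)
      have hnx : ‖(q : ℂ)⁻¹ ^ (n + 1)‖ = x := by rw [norm_pow, norm_inv_natCast]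
      have h1 : (1 - x) * ‖PowerSeries.coeff (n + 1) B‖ ≤ (1 + x) * M := by
        calc (1 - x) * ‖PowerSeries.coeff (n + 1) B‖
            ≤ ‖1 - (q : ℂ)⁻¹ ^ (n + 1)‖ * ‖PowerSeries.coeff (n + 1) B‖ := by
              gcongr
              rw [← hnx]
              simpa using norm_sub_norm_le (1 : ℂ) ((q : ℂ)⁻¹ ^ (n + 1))
          _ ≤ (1 + x) * M := by
              rw [← norm_mul, coeff_succ_of_functionalEquation h]
              refine (norm_sub_le _ _).trans ?_
              rw [add_mul, one_mul]
              refine add_le_add (ih n (by omega)) ?_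
              split_ifs
              · rw [norm_mul, hnx]
                gcongr
                exact (ih _ (by omega)).trans (hmono _ _ (by omega))
              · simpa using by positivity
      -- This amounts to 4x² ≤ 2x, which is where x ≤ 1/2, that is q ≥ 2, enters.
      have h2 : (1 + x) ≤ (1 - x) * (1 + 4 * x) := by nlinarith
      have h3 : ‖PowerSeries.coeff (n + 1) B‖ ≤ (1 + 4 * x) * M := by
        refine le_of_mul_le_mul_left (h1.trans ?_) (by linarith : 0 < 1 - x)
        rw [← mul_assoc]
        gcongr
      refine h3.trans ?_
      rw [Finset.sum_range_succ, mul_add, Real.exp_add, mul_comm]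
      gcongr
      linarith [Real.add_one_le_exp (4 * x)]

theorem exists_norm_coeff_le (hq : 1 < q) (hd : 0 < d) {B : ℂ⟦X⟧}
    (h : B = bFactor q d 0 * PowerSeries.rescale (q : ℂ)⁻¹ B)
    (h0 : PowerSeries.coeff 0 B = 1) :
    ∃ C : ℝ, ∀ n, ‖PowerSeries.coeff n B‖ ≤ C := by
  refine ⟨Real.exp (4 * ∑' i : ℕ, (q : ℝ)⁻¹ ^ (i + 1)), fun n => ?_⟩
  refine (norm_coeff_le_exp hq hd h h0 n).trans ?_
  gcongr
  exact ((summable_nat_add_iff 1).2 (summable_inv_pow hq)).sum_le_tsum _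
    fun i _ => by positivity

theorem hasSum_coeff_one_sub_C_mul_X_pow_mul {F : ℂ⟦X⟧} {x s : ℂ}
    (h : HasSum (fun n => PowerSeries.coeff n F * x ^ n) s) (c : ℂ) (d : ℕ) :
    HasSum (fun n => PowerSeries.coeff n
      ((1 - (PowerSeries.C c * PowerSeries.X) ^ d) * F) * x ^ n) ((1 - (c * x) ^ d) * s) := by
  have he : (fun n => PowerSeries.coeff n
      ((1 - (PowerSeries.C c * PowerSeries.X) ^ d) * F) * x ^ n) = fun n =>
      PowerSeries.coeff n F * x ^ n -
        (if d ≤ n then c ^ d * PowerSeries.coeff (n - d) F else 0) * x ^ n := by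
    funext n
    rw [coeff_one_sub_C_mul_X_pow_mul, sub_mul]
  rw [he, sub_mul, one_mul]
  refine h.sub ?_
  rw [← hasSum_nat_add_iff' d]
  have : ∑ i ∈ Finset.range d,
      (if d ≤ i then c ^ d * PowerSeries.coeff (i - d) F else 0) * x ^ i = 0 :=
    Finset.sum_eq_zero fun i hi => by
      rw [if_neg (by simpa using hi), zero_mul]
  rw [this, sub_zero]
  have he' : (fun n => (if d ≤ n + d then c ^ d * PowerSeries.coeff (n + d - d) F else 0) *
      x ^ (n + d)) = fun n => (c * x) ^ d * (PowerSeries.coeff n F * x ^ n) := by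
    funext n
    rw [if_pos (Nat.le_add_left d n), Nat.add_sub_cancel]
    ring
  rw [he']
  exact h.mul_left _

theorem summable_coeff_mul_pow {B : ℂ⟦X⟧} {C : ℝ} (hC : ∀ n, ‖PowerSeries.coeff n B‖ ≤ C) {x : ℂ}
    (hx : ‖x‖ < 1) : Summable fun n => PowerSeries.coeff n B * x ^ n := by
  refine Summable.of_norm_bounded ((summable_geometric_of_lt_one (norm_nonneg x) hx).mul_left C)
    fun n => ?_
  rw [norm_mul, norm_pow]
  gcongr
  exact hC n

theorem tsum_functionalEquation {B : ℂ⟦X⟧}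
    (h : B = bFactor q d 0 * PowerSeries.rescale (q : ℂ)⁻¹ B) {x : ℂ}
    (hs : Summable fun n => PowerSeries.coeff n B * x ^ n)
    (hs' : Summable fun n => PowerSeries.coeff n B * ((q : ℂ)⁻¹ * x) ^ n) :
    (1 - x) * ∑' n, PowerSeries.coeff n B * x ^ n =
      (1 - ((q : ℂ)⁻¹ * x) ^ d) * ∑' n, PowerSeries.coeff n B * ((q : ℂ)⁻¹ * x) ^ n := by
  have h1 := hasSum_coeff_one_sub_C_mul_X_pow_mul hs.hasSum 1 1
  have h2 : HasSum (fun n => PowerSeries.coeff n (PowerSeries.rescale (q : ℂ)⁻¹ B) * x ^ n)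
      (∑' n, PowerSeries.coeff n B * ((q : ℂ)⁻¹ * x) ^ n) := by
    convert hs'.hasSum using 2 with n
    rw [PowerSeries.coeff_rescale, mul_pow]
    ring
  have h3 := hasSum_coeff_one_sub_C_mul_X_pow_mul h2 (q : ℂ)⁻¹ d
  rw [← one_sub_X_mul_eq h] at h3
  simp only [map_one, one_mul, pow_one] at h1
  exact h1.unique h3

/-- The coefficients of (1 - u)B telescope: their partial sums are the coefficients of B. The other
side of the functional equation is summable at u = 1 and gives the limit. -/
theorem tendsto_coeff_of_functionalEquation {B : ℂ⟦X⟧}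
    (h : B = bFactor q d 0 * PowerSeries.rescale (q : ℂ)⁻¹ B)
    (hs : Summable fun n => PowerSeries.coeff n B * (q : ℂ)⁻¹ ^ n) :
    Tendsto (fun n => PowerSeries.coeff n B) atTop
      (𝓝 ((1 - (q : ℂ)⁻¹ ^ d) * ∑' n, PowerSeries.coeff n B * (q : ℂ)⁻¹ ^ n)) := by
  have h2 : HasSum (fun n => PowerSeries.coeff n (PowerSeries.rescale (q : ℂ)⁻¹ B) * 1 ^ n)
      (∑' n, PowerSeries.coeff n B * (q : ℂ)⁻¹ ^ n) := by
    convert hs.hasSum using 2 with n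
    rw [PowerSeries.coeff_rescale]
    ring
  have h3 := hasSum_coeff_one_sub_C_mul_X_pow_mul h2 (q : ℂ)⁻¹ d
  rw [← one_sub_X_mul_eq h] at h3
  simp only [one_pow, mul_one] at h3
  have h4 := h3.tendsto_sum_nat.comp (tendsto_add_atTop_nat 1)
  refine h4.congr fun n => ?_
  simp only [Function.comp_apply]
  induction n with
  | zero => simp [sub_mul]
  | succ n ih =>
    rw [Finset.sum_range_succ, ih, sub_mul, one_mul, map_sub, PowerSeries.coeff_succ_X_mul]
    ring

/-- By dominated convergence, only the constant term survives. -/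
theorem tendsto_tsum_coeff_mul_pow_pow {B : ℂ⟦X⟧} {C : ℝ} (hC : ∀ n, ‖PowerSeries.coeff n B‖ ≤ C)
    {a : ℂ} (ha : ‖a‖ < 1) :
    Tendsto (fun N : ℕ => ∑' n, PowerSeries.coeff n B * (a ^ (N + 1)) ^ n) atTop
      (𝓝 (PowerSeries.coeff 0 B)) := by
  have hC0 : 0 ≤ C := (norm_nonneg _).trans (hC 0)
  have h0 : ∑' n, (if n = 0 then PowerSeries.coeff 0 B else 0) = PowerSeries.coeff 0 B :=
    tsum_ite_eq 0 _
  rw [← h0]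
  refine tendsto_tsum_of_dominated_convergence (bound := fun n => C * ‖a‖ ^ n)
    ((summable_geometric_of_lt_one (norm_nonneg a) ha).mul_left C) (fun n => ?_)
    (Eventually.of_forall fun N n => ?_)
  · split_ifs with hn
    · subst hn; simp
    · have : Tendsto (fun N : ℕ => (a ^ n) ^ (N + 1)) atTop (𝓝 0) :=
        (tendsto_pow_atTop_nhds_zero_of_norm_lt_one (by
          rw [norm_pow]; exact pow_lt_one₀ (norm_nonneg a) ha hn)).comp
          (tendsto_add_atTop_nat 1)
      simpa [← pow_mul, mul_comm] using this.const_mul (PowerSeries.coeff n B)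
  · rw [norm_mul, norm_pow, norm_pow]
    gcongr
    · exact hC n
    · exact pow_le_of_le_one (norm_nonneg a) ha.le (by simp)

theorem multipliable_one_sub_inv_pow (𝕜 : Type*) [RCLike 𝕜] (hq : 1 < q) (hd : 0 < d) :
    Multipliable fun j : ℕ => 1 - (q : 𝕜)⁻¹ ^ ((j + 1) * d) := by
  simp only [sub_eq_add_neg]
  refine multipliable_one_add_of_summable ?_
  refine Summable.of_nonneg_of_le (fun j => norm_nonneg _) (fun j => ?_) (summable_inv_pow hq)
  rw [norm_neg, norm_pow, norm_inv, RCLike.norm_natCast]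
  exact pow_le_pow_of_le_one (by positivity) (by linarith [inv_natCast_le_half hq]) (by nlinarith)

theorem multipliable_one_sub_div (hq : 1 < q) (d : ℕ) :
    Multipliable fun j : ℕ => (1 - (q : ℂ)⁻¹ ^ ((j + 1) * d)) / (1 - (q : ℂ)⁻¹ ^ (j + 1)) := by
  rcases Nat.eq_zero_or_pos d with rfl | hd
  · simpa using (hasProd_fun_zero (M := ℂ)).multipliable
  have heq (j : ℕ) : (1 - (q : ℂ)⁻¹ ^ ((j + 1) * d)) / (1 - (q : ℂ)⁻¹ ^ (j + 1)) =
      1 + ((q : ℂ)⁻¹ ^ (j + 1) - (q : ℂ)⁻¹ ^ ((j + 1) * d)) / (1 - (q : ℂ)⁻¹ ^ (j + 1)) := by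
    rw [one_add_div (one_sub_inv_pow_succ_ne_zero hq j)]
    congr 1
    ring
  simp only [heq]
  refine multipliable_one_add_of_summable ?_
  -- The constant 4 comes from a numerator of norm at most 2 q^(-j) over a denominator of norm at
  -- least 1/2.
  refine Summable.of_nonneg_of_le (fun j => norm_nonneg _) (fun j => ?_)
    ((summable_inv_pow hq).mul_left 4)
  have h0 : (0 : ℝ) ≤ (q : ℝ)⁻¹ := by positivity
  have h1 : (q : ℝ)⁻¹ ≤ 1 := by linarith [inv_natCast_le_half hq]
  have hden : 1 / 2 ≤ ‖1 - (q : ℂ)⁻¹ ^ (j + 1)‖ := by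
    have h2 := norm_sub_norm_le (1 : ℂ) ((q : ℂ)⁻¹ ^ (j + 1))
    rw [norm_one, norm_pow, norm_inv_natCast] at h2
    have h3 : (q : ℝ)⁻¹ ^ (j + 1) ≤ (q : ℝ)⁻¹ := pow_le_of_le_one h0 h1 (by simp)
    linarith [inv_natCast_le_half hq]
  have hnum : ‖(q : ℂ)⁻¹ ^ (j + 1) - (q : ℂ)⁻¹ ^ ((j + 1) * d)‖ ≤ 2 * (q : ℝ)⁻¹ ^ j := by
    refine (norm_sub_le _ _).trans ?_
    rw [norm_pow, norm_pow, norm_inv_natCast, two_mul]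
    exact add_le_add (pow_le_pow_of_le_one h0 h1 (by omega))
      (pow_le_pow_of_le_one h0 h1 (by nlinarith))
  rw [norm_div, div_le_iff₀ (by linarith)]
  have : 0 ≤ (q : ℝ)⁻¹ ^ j := by positivity
  nlinarith

theorem tendsto_bCoeff (hq : 1 < q) (d : ℕ) :
    Tendsto (fun n : ℕ => bCoeff q n d) atTop
      (𝓝 (∏' j : ℕ, (1 - (q : ℂ)⁻¹ ^ ((j + 1) * d)) / (1 - (q : ℂ)⁻¹ ^ (j + 1)))) := by
  rcases Nat.eq_zero_or_pos d with rfl | hd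
  · have h1 : ∏' j, bFactor q 0 j = 0 := by
      simp only [bFactor_zero_right]
      exact hasProd_fun_zero.tprod_eq
    simp only [bCoeff, h1, mul_zero, pow_zero, sub_self, zero_div]
    rw [(hasProd_fun_zero (M := ℂ)).tprod_eq]
    simp
  set B := ∏' j, bFactor q d j with hB
  have h : B = bFactor q d 0 * PowerSeries.rescale (q : ℂ)⁻¹ B := tprod_bFactor_eq hq d
  have h0 : PowerSeries.coeff 0 B = 1 := by
    rw [PowerSeries.coeff_zero_eq_constantCoeff_apply, hB, constantCoeff_tprod_bFactor hq hd]
  obtain ⟨C, hC⟩ := exists_norm_coeff_le hq hd h h0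
  set a : ℂ := (q : ℂ)⁻¹ with ha
  have hna : ‖a‖ < 1 := by
    rw [ha, norm_inv_natCast]; linarith [inv_natCast_le_half hq]
  have hs (N : ℕ) : Summable fun n => PowerSeries.coeff n B * (a ^ (N + 1)) ^ n :=
    summable_coeff_mul_pow hC (by
      rw [norm_pow]; exact pow_lt_one₀ (norm_nonneg a) hna (by simp))
  have hL : Tendsto (fun n => PowerSeries.coeff n B) atTop
      (𝓝 ((1 - a ^ d) * ∑' n, PowerSeries.coeff n B * a ^ n)) :=
    tendsto_coeff_of_functionalEquation h (by
      have := hs 0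
      simp only [zero_add, pow_one] at this
      exact this)
  -- The functional equation at x = a^(N+1) extracts one factor per step. The left side does not
  -- depend on N, so N can tend to infinity.
  have hprod (N : ℕ) : (1 - a ^ d) * ∑' n, PowerSeries.coeff n B * a ^ n =
      (∏ j ∈ Finset.range N, (1 - a ^ ((j + 1) * d)) / (1 - a ^ (j + 1))) *
        ((1 - (a ^ d) ^ (N + 1)) * ∑' n, PowerSeries.coeff n B * (a ^ (N + 1)) ^ n) := by
    induction N with
    | zero => simp
    | succ N ih =>
      have hf := tsum_functionalEquation h (hs N) (by
        rw [← ha, ← pow_succ']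
        exact hs (N + 1))
      have hne := one_sub_inv_pow_succ_ne_zero hq N
      rw [← ha] at hf hne
      rw [← pow_succ'] at hf
      rw [ih, Finset.prod_range_succ, mul_assoc]
      congr 1
      rw [div_mul_eq_mul_div, eq_div_iff hne, ← pow_mul a d (N + 1), mul_comm d (N + 1),
        ← pow_mul a d, mul_comm d, pow_mul a (N + 1 + 1) d]
      linear_combination (1 - a ^ ((N + 1) * d)) * hf
  have hlim : Tendsto (fun N : ℕ =>
      (∏ j ∈ Finset.range N, (1 - a ^ ((j + 1) * d)) / (1 - a ^ (j + 1))) *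
        ((1 - (a ^ d) ^ (N + 1)) * ∑' n, PowerSeries.coeff n B * (a ^ (N + 1)) ^ n)) atTop
      (𝓝 ((∏' j : ℕ, (1 - a ^ ((j + 1) * d)) / (1 - a ^ (j + 1))) * ((1 - 0) * 1))) := by
    refine (multipliable_one_sub_div hq d).hasProd.tendsto_prod_nat.mul (Tendsto.mul ?_ ?_)
    · refine tendsto_const_nhds.sub ((tendsto_pow_atTop_nhds_zero_of_norm_lt_one (by
          rw [norm_pow]; exact pow_lt_one₀ (norm_nonneg a) hna hd.ne')).comp
          (tendsto_add_atTop_nat 1))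
    · rw [← h0]; exact tendsto_tsum_coeff_mul_pow_pow hC hna
  simp only [← hprod, sub_zero, mul_one] at hlim
  rw [← tendsto_nhds_unique tendsto_const_nhds hlim]
  exact hL

end Limit

/-! ### The order of GL_n. -/

section GLCount

/-- The order of `GL_n` over a field with `q` elements, as a complex number. -/
noncomputable def glCount (q n : ℕ) : ℂ := ∏ i ∈ Finset.range n, ((q : ℂ) ^ n - (q : ℂ) ^ i)

theorem natCast_prod_pow_sub_pow {q m n : ℕ} (hq : 0 < q) (hmn : m ≤ n) :
    ((∏ i ∈ Finset.range m, (q ^ n - q ^ i) : ℕ) : ℂ) =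
      ∏ i ∈ Finset.range m, ((q : ℂ) ^ n - (q : ℂ) ^ i) := by
  rw [Nat.cast_prod]
  refine Finset.prod_congr rfl fun i hi => ?_
  rw [Nat.cast_sub (Nat.pow_le_pow_right hq ((Finset.mem_range.1 hi).le.trans hmn))]
  simp

/-- Division by `glCount` thus removes both the number of injections and the off-diagonal power of
q, leaving a convolution in `regularCount_mul_card`. -/
theorem prod_mul_glCount_sub {q m n : ℕ} (hmn : m ≤ n) :
    (∏ i ∈ Finset.range m, ((q : ℂ) ^ n - (q : ℂ) ^ i)) *
      ((q : ℂ) ^ (m * (n - m)) * glCount q (n - m)) = glCount q n := by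
  obtain ⟨k, rfl⟩ := Nat.exists_eq_add_of_le hmn
  rw [Nat.add_sub_cancel_left, glCount, glCount, Finset.prod_range_add, pow_mul]
  congr 1
  have : ((q : ℂ) ^ m) ^ k = ∏ i ∈ Finset.range k, (q : ℂ) ^ m := by simp
  rw [this, ← Finset.prod_mul_distrib]
  exact Finset.prod_congr rfl fun i _ => by rw [mul_sub, ← pow_add, ← pow_add]

theorem prod_Icc_one_eq_prod_range {M : Type*} [CommMonoid M] (f : ℕ → M) (n : ℕ) :
    ∏ i ∈ Finset.Icc 1 n, f i = ∏ i ∈ Finset.range n, f (i + 1) := by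
  induction n with
  | zero => simp
  | succ n ih => rw [Finset.prod_Icc_succ_top (by omega), ih, Finset.prod_range_succ]

theorem glCount_eq {q : ℕ} (hq : q ≠ 0) (n : ℕ) :
    glCount q n = (q : ℂ) ^ (n * n) * ∏ i ∈ Finset.Icc 1 n, (1 - (q : ℂ)⁻¹ ^ i) := by
  have hq' : (q : ℂ) ≠ 0 := by exact_mod_cast hq
  have h2 : (q : ℂ) ^ (n * n) = ∏ i ∈ Finset.range n, (q : ℂ) ^ n := by simp [pow_mul]
  rw [prod_Icc_one_eq_prod_range, h2,
    ← Finset.prod_range_reflect fun i => 1 - (q : ℂ)⁻¹ ^ (i + 1), ← Finset.prod_mul_distrib, glCount]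
  refine Finset.prod_congr rfl fun i hi => ?_
  have hi' := Finset.mem_range.1 hi
  rw [mul_sub, mul_one, show n - 1 - i + 1 = n - i by omega]
  congr 1
  rw [inv_pow, eq_mul_inv_iff_mul_eq₀ (pow_ne_zero _ hq'), ← pow_add]
  congr 1
  omega

theorem glCount_ne_zero {q : ℕ} (hq : 1 < q) (n : ℕ) : glCount q n ≠ 0 := by
  rw [glCount_eq (by omega)]
  refine mul_ne_zero (pow_ne_zero _ (by exact_mod_cast (by omega))) ?_
  rw [prod_Icc_one_eq_prod_range]
  exact Finset.prod_ne_zero_iff.2 fun i _ => one_sub_inv_pow_succ_ne_zero hq i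

end GLCount

/-! ### Identification of `bCoeff` with `regularCount` over |GL_n|. -/

section RegularSeries

variable {K : Type*} [Field K]

/-- The generating series of `|{B ∈ Mat_n(K) : P(B) invertible}| / |GL_n(K)|`. -/
noncomputable def regularSeries (P : K[X]) : ℂ⟦X⟧ :=
  PowerSeries.mk fun n => (regularCount P (Fin n → K) : ℂ) / glCount (Nat.card K) n

theorem regularCount_of_subsingleton (P : K[X]) (V : Type*) [AddCommGroup V] [Module K V]
    [Subsingleton V] : regularCount P V = 1 := by
  rw [regularCount, Nat.card_eq_one_iff_unique]
  exact ⟨⟨fun a b => Subtype.ext (Subsingleton.elim _ _)⟩,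
    ⟨⟨0, Function.injective_of_subsingleton _⟩⟩⟩

variable [Finite K]

theorem pow_mul_coeff_regularSeries {P : K[X]} (hP : Irreducible P) (n : ℕ) :
    (Nat.card K : ℂ) ^ n * PowerSeries.coeff n (regularSeries P) =
      ∑ m ∈ Finset.range (n + 1),
        (coprimeMonicCount P m : ℂ) * PowerSeries.coeff (n - m) (regularSeries P) := by
  have hq : 1 < Nat.card K := Finite.one_lt_card
  have hrec := congrArg (Nat.cast (R := ℂ)) (regularCount_mul_card (V := Fin n → K) hP)
  rw [Module.natCard_eq_pow_finrank (K := K), Module.finrank_fin_fun, Nat.cast_sum] at hrec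
  rw [regularSeries, PowerSeries.coeff_mk, mul_div_assoc', div_eq_iff (glCount_ne_zero hq n),
    Finset.sum_mul]
  push_cast at hrec
  rw [mul_comm, hrec]
  refine Finset.sum_congr rfl fun m hm => ?_
  have hmn : m ≤ n := Nat.lt_succ_iff.1 (Finset.mem_range.1 hm)
  have h0 := glCount_ne_zero hq (n - m)
  have hc := natCast_prod_pow_sub_pow (q := Nat.card K) (by omega) hmn
  rw [Nat.cast_prod] at hc
  rw [hc, PowerSeries.coeff_mk, ← prod_mul_glCount_sub hmn]
  field_simp

/-- The m-th coefficient of (1 - (u/q)^d)/(1 - u) is q^(-m) times the number of monic polynomials of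
degree m prime to P. The recursion divided by q^n is therefore the product formula for coefficients.
-/
theorem regularSeries_functionalEquation {P : K[X]} (hPm : P.Monic) (hP : Irreducible P) :
    regularSeries P = bFactor (Nat.card K) P.natDegree 0 *
      PowerSeries.rescale (Nat.card K : ℂ)⁻¹ (regularSeries P) := by
  set q := Nat.card K with hq
  have hq1 : 1 < q := Finite.one_lt_card
  have hq0 : (q : ℂ) ≠ 0 := by exact_mod_cast (by omega)
  have hC (m : ℕ) : (q : ℂ)⁻¹ ^ m * coprimeMonicCount P m =
      PowerSeries.coeff m (bFactor q P.natDegree 0) := by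
    have := congrArg (Nat.cast (R := ℂ)) (coprimeMonicCount_add hPm m)
    rw [coeff_bFactor]
    push_cast at this
    rw [← hq] at this
    rw [← eq_sub_iff_add_eq] at this
    rw [this, mul_sub]
    congr 1
    · rw [← mul_pow, inv_mul_cancel₀ hq0]; simp
    · split_ifs with h
      · obtain ⟨k, rfl⟩ := Nat.exists_eq_add_of_le h
        rw [Nat.add_sub_cancel_left, pow_add, mul_assoc, ← mul_pow, inv_mul_cancel₀ hq0]
        simp
      · simp
  ext n
  refine mul_left_cancel₀ (pow_ne_zero n hq0) ?_
  rw [hq, pow_mul_coeff_regularSeries hP, ← hq, PowerSeries.coeff_mul,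
    Finset.Nat.sum_antidiagonal_eq_sum_range_succ_mk, Finset.mul_sum]
  refine Finset.sum_congr rfl fun m hm => ?_
  have hmn : m ≤ n := Nat.lt_succ_iff.1 (Finset.mem_range.1 hm)
  obtain ⟨k, rfl⟩ := Nat.exists_eq_add_of_le hmn
  rw [← hC, PowerSeries.coeff_rescale, Nat.add_sub_cancel_left, pow_add]
  have h1 : (q : ℂ) ^ m * (q : ℂ)⁻¹ ^ m = 1 := by rw [← mul_pow, mul_inv_cancel₀ hq0, one_pow]
  have h2 : (q : ℂ) ^ k * (q : ℂ)⁻¹ ^ k = 1 := by rw [← mul_pow, mul_inv_cancel₀ hq0, one_pow]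
  linear_combination -(coprimeMonicCount P m * PowerSeries.coeff k (regularSeries P)) *
    ((q : ℂ) ^ k * (q : ℂ)⁻¹ ^ k * h1 + h2)

theorem bCoeff_natDegree_eq {P : K[X]} (hPm : P.Monic) (hP : Irreducible P) (n : ℕ) :
    bCoeff (Nat.card K) n P.natDegree =
      (regularCount P (Fin n → K) : ℂ) / glCount (Nat.card K) n := by
  rw [bCoeff, tprod_bFactor_eq_of_functionalEquation Finite.one_lt_card hP.natDegree_pos
    (regularSeries_functionalEquation hPm hP), regularSeries, PowerSeries.coeff_mk]
  rw [regularSeries, PowerSeries.coeff_mk, regularCount_of_subsingleton]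
  simp [glCount]

end RegularSeries

/-! ### The probability and its limit. -/

section Probability

theorem card_linearEquiv_ne_zero {K H : Type*} [Field K] [Finite K] [AddCommGroup H] [Module K H]
    [Module K[X] H] [Module.Finite K H] : Nat.card (H ≃ₗ[K[X]] H) ≠ 0 := by
  have : Finite H := Module.finite_of_finite K
  have : Finite (H ≃ₗ[K[X]] H) := Finite.of_injective (fun e => (e : H → H)) DFunLike.coe_injective
  exact Nat.card_ne_zero.2 ⟨⟨LinearEquiv.refl _ _⟩, this⟩

variable {K : Type*} [Field K] {P : K[X]} {H : Type*} [AddCommGroup H] [Module K H]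
  [Module K[X] H] [IsScalarTower K K[X] H]

/-- H is a finite sum of cyclic modules, each a quotient of some K[t]/(P^k), which is
finite-dimensional. -/
theorem finite_of_isFiniteLength_of_isTorsion (hP : P.Monic) (hlen : IsFiniteLength K[X] H)
    (htors : Module.IsTorsion' H (Submonoid.powers P)) : Module.Finite K H := by
  have hN : IsNoetherian K[X] H := (isFiniteLength_iff_isNoetherian_isArtinian.1 hlen).1
  have key : ∀ N : Submodule K[X] H, N.FG → (N.restrictScalars K).FG := by
    intro N hNfg
    refine Submodule.fg_induction (motive := fun N _ => (N.restrictScalars K).FG) (fun x => ?_)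
      (fun N₁ N₂ _ _ h₁ h₂ => ?_) N hNfg
    · obtain ⟨⟨a, k, rfl⟩, ha⟩ := @htors x
      have ha' : P ^ k • x = 0 := ha
      have : Module.Finite K (K[X] ⧸ Ideal.span {P ^ k}) := (hP.pow k).finite_quotient
      let φ : (K[X] ⧸ Ideal.span {P ^ k}) →ₗ[K[X]] H :=
        (Ideal.span {P ^ k}).liftQ (LinearMap.toSpanSingleton K[X] H x) fun p hp => by
          obtain ⟨c, rfl⟩ := Ideal.mem_span_singleton.1 hp
          rw [LinearMap.mem_ker, LinearMap.toSpanSingleton_apply, mul_comm, mul_smul, ha',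
            smul_zero]
      have hφ : (Submodule.span K[X] {x}).restrictScalars K =
          LinearMap.range (φ.restrictScalars K) := by
        ext y
        rw [LinearMap.mem_range, Submodule.restrictScalars_mem, Submodule.mem_span_singleton]
        constructor
        · rintro ⟨p, rfl⟩
          exact ⟨Submodule.Quotient.mk p, rfl⟩
        · rintro ⟨z, rfl⟩
          obtain ⟨p, rfl⟩ := Submodule.Quotient.mk_surjective _ z
          exact ⟨p, rfl⟩
      rw [hφ]
      exact Module.Finite.iff_fg.1 inferInstance
    · rw [Submodule.restrictScalars_sup]
      exact h₁.sup h₂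
  exact ⟨by simpa using key ⊤ (IsNoetherian.noetherian _)⟩

variable [Finite K]

theorem probPartIso_eq_zero [Module.Finite K H] {n : ℕ} (hn : n < Module.finrank K H) :
    probPartIso P H n = 0 := by
  rw [probPartIso, uniformProb]
  have : IsEmpty {A : Matrix (Fin n) (Fin n) K |
      Nonempty (primePowerTorsion K[X] (matrixModule A) P ≃ₗ[K[X]] H)} := by
    refine ⟨fun ⟨A, ⟨e⟩⟩ => hn.not_ge ?_⟩
    have hi : Function.Injective (((Submodule.subtype _).comp e.symm.toLinearMap).restrictScalars K)
      := Subtype.val_injective.comp e.symm.injective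
    have := LinearMap.finrank_le_finrank_of_injective (R := K)
      (f := (Module.AEval'.of (Matrix.toLin' A)).symm.toLinearMap ∘ₗ
        ((Submodule.subtype _).comp e.symm.toLinearMap).restrictScalars K)
      ((Module.AEval'.of (Matrix.toLin' A)).symm.injective.comp hi)
    simpa using this
  rw [Nat.card_of_isEmpty]
  simp

theorem probPartIso_eq [Module.Finite K H] (hPm : P.Monic) (hP : Irreducible P)
    (htors : Module.IsTorsion' H (Submonoid.powers P)) {n : ℕ} (hn : Module.finrank K H ≤ n) :
    (probPartIso P H n : ℂ) = bCoeff (Nat.card K) (n - Module.finrank K H) P.natDegree /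
      (Nat.card (H ≃ₗ[K[X]] H) : ℂ) * ∏ i ∈ Finset.Icc 1 n, (1 - (Nat.card K : ℂ)⁻¹ ^ i) := by
  set h := Module.finrank K H with hh
  set q := Nat.card K with hq
  have hq1 : 1 < q := Finite.one_lt_card
  have hq0 : (q : ℂ) ≠ 0 := by exact_mod_cast (by omega)
  have h1 := card_isoTorsion_mul_card_aut htors n
  rw [card_regularEmbedding (F := Fin (n - h) → K) P (by simp; omega), Module.finrank_fin_fun,
    Module.finrank_fin_fun] at h1
  have h2 := congrArg (Nat.cast (R := ℂ)) h1
  rw [Nat.cast_mul, Nat.cast_mul, natCast_prod_pow_sub_pow (by omega) hn, Nat.cast_mul,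
    Nat.cast_pow] at h2
  have hmat : Nat.card (Matrix (Fin n) (Fin n) K) = q ^ (n * n) := by
    rw [Module.natCard_eq_pow_finrank (K := K), Module.finrank_matrix]
    simp [hq]
  have hA : (Nat.card (H ≃ₗ[K[X]] H) : ℂ) ≠ 0 := by
    exact_mod_cast card_linearEquiv_ne_zero (K := K)
  have hg := glCount_ne_zero hq1 (n - h)
  rw [bCoeff_natDegree_eq hPm hP, probPartIso, uniformProb, hmat]
  push_cast
  rw [div_eq_iff (pow_ne_zero _ hq0)]
  refine mul_right_cancel₀ hA ?_
  rw [h2]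
  have h3 := prod_mul_glCount_sub (q := q) hn
  rw [glCount_eq (by omega) n] at h3
  -- Here D counts the injections H → K^n, x = q^(h(n-h)), N is `regularCount` and g is `glCount` in
  -- dimension n - h, A = |Aut H|, M = q^(n²), and M G is |GL_n|.
  have h4 : ∀ D N g A G M x : ℂ, A ≠ 0 → g ≠ 0 → D * (x * g) = M * G →
      D * (x * N) = N / g / A * G * M * A := by
    intro D N g A G M x hA hg hD
    field_simp
    linear_combination N * hD
  exact h4 _ _ _ _ _ _ _ hA hg h3

/-- The denominators in the limit of `bCoeff` cancel factor by factor against ∏ (1 - q^(-i)). -/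
theorem tendsto_probPartIso [Module.Finite K H] (hPm : P.Monic) (hP : Irreducible P)
    (htors : Module.IsTorsion' H (Submonoid.powers P)) :
    Tendsto (fun n => (probPartIso P H n : ℂ)) atTop (𝓝 (1 / (Nat.card (H ≃ₗ[K[X]] H) : ℂ) *
      ∏' j : ℕ, (1 - (Nat.card K : ℂ)⁻¹ ^ ((j + 1) * P.natDegree)))) := by
  set q := Nat.card K with hq
  have hq1 : 1 < q := Finite.one_lt_card
  have hm := multipliable_one_sub_inv_pow ℂ hq1 one_pos
  simp only [mul_one] at hm
  have hprod := (multipliable_one_sub_div hq1 P.natDegree).tprod_mul hm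
  simp only [div_mul_cancel₀ _ (one_sub_inv_pow_succ_ne_zero hq1 _)] at hprod
  rw [hprod]
  have h1 := (tendsto_bCoeff hq1 P.natDegree).comp (tendsto_sub_atTop_nat (Module.finrank K H))
  have h2 : Tendsto (fun n => ∏ i ∈ Finset.Icc 1 n, (1 - (q : ℂ)⁻¹ ^ i)) atTop
      (𝓝 (∏' j : ℕ, (1 - (q : ℂ)⁻¹ ^ (j + 1)))) := by
    refine hm.hasProd.tendsto_prod_nat.congr fun n => ?_
    rw [prod_Icc_one_eq_prod_range]
  have h3 := (h1.div_const (Nat.card (H ≃ₗ[K[X]] H) : ℂ)).mul h2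
  rw [← mul_assoc, one_div_mul_eq_div]
  refine h3.congr' ?_
  filter_upwards [eventually_ge_atTop (Module.finrank K H)] with n hn
  rw [probPartIso_eq hPm hP htors hn]
  rfl

end Probability

theorem mainTheorem5 {K : Type*} [Field K] [Finite K] (P : K[X]) (hPmonic : P.Monic)
    (hPirr : Irreducible P) (H : Type*) [AddCommGroup H] [Module K H] [Module K[X] H]
    [IsScalarTower K K[X] H] (hlen : IsFiniteLength K[X] H)
    (htors : Module.IsTorsion' H (Submonoid.powers P)) :
    (∀ d : ℕ, Multipliable (bFactor (Nat.card K) d)) ∧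
    (∀ n : ℕ, (probPartIso P H n : ℂ) =
      if Module.finrank K H ≤ n then
        bCoeff (Nat.card K) (n - Module.finrank K H) P.natDegree /
            (Nat.card (H ≃ₗ[K[X]] H) : ℂ) *
          ∏ i ∈ Finset.Icc 1 n, (1 - (Nat.card K : ℂ)⁻¹ ^ i)
      else 0) ∧
    (∀ d : ℕ,
      Multipliable (fun j : ℕ =>
        (1 - (Nat.card K : ℂ)⁻¹ ^ ((j + 1) * d)) / (1 - (Nat.card K : ℂ)⁻¹ ^ (j + 1))) ∧
      Tendsto (fun n : ℕ => bCoeff (Nat.card K) n d) atTop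
        (𝓝 (∏' j : ℕ,
          (1 - (Nat.card K : ℂ)⁻¹ ^ ((j + 1) * d)) / (1 - (Nat.card K : ℂ)⁻¹ ^ (j + 1))))) ∧
    Multipliable (fun j : ℕ => 1 - (Nat.card K : ℝ)⁻¹ ^ ((j + 1) * P.natDegree)) ∧
    Tendsto (fun n : ℕ => probPartIso P H n) atTop
      (𝓝 (1 / (Nat.card (H ≃ₗ[K[X]] H) : ℝ) *
        ∏' j : ℕ, (1 - (Nat.card K : ℝ)⁻¹ ^ ((j + 1) * P.natDegree)))) := by
  have : Module.Finite K H := finite_of_isFiniteLength_of_isTorsion hPmonic hlen htors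
  have hq : 1 < Nat.card K := Finite.one_lt_card
  have hmR := multipliable_one_sub_inv_pow ℝ hq hPirr.natDegree_pos
  refine ⟨multipliable_bFactor hq, fun n => ?_,
    fun d => ⟨multipliable_one_sub_div hq d, tendsto_bCoeff hq d⟩, hmR, ?_⟩
  · split_ifs with hn
    · exact probPartIso_eq hPmonic hPirr htors hn
    · rw [probPartIso_eq_zero (by omega), Complex.ofReal_zero]
  -- The real statement follows by taking real parts, since the complex product is the image of the
  -- real one.
  · have h1 := (Complex.continuous_re.tendsto _).comp (tendsto_probPartIso hPmonic hPirr htors)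
    have h2 := hmR.map_tprod Complex.ofRealHom Complex.continuous_ofReal
    simp only [Complex.ofRealHom_eq_coe, Complex.ofReal_sub, Complex.ofReal_one, Complex.ofReal_pow,
      Complex.ofReal_inv, Complex.ofReal_natCast] at h2
    rw [← h2, ← Complex.ofReal_natCast, ← Complex.ofReal_one, ← Complex.ofReal_div,
      ← Complex.ofReal_mul, Complex.ofReal_re] at h1
    exact h1
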